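/- A labeling of a finite simple graph $G$ on $n\ge 1$ vertices assigns to the vertices distinct labels from $[n]=\{1,\dots,n\}$. It is $\{I_3,J_4,Q_4\}$-free if no induced subgraph, after replacing its $i$-th smallest label by $i$ for every $i$, equals one of the labeled graphs $I_3$ (vertices $1,2,3$, edges $12,23$), $J_4$ (vertices $1,2,3,4$, edges $13,24$), $Q_4$ (vertices $1,2,3,4$, edges $14,23$). A $12$-representant of a labeled graph is a word $w$ whose set of letters is $[n]$ and such that, for any two distinct labels $i<j$, the vertices labeled $i$ and $j$ are adjacent if and only if the subword of $w$ formed by all occurrences of $i$ and $j$ does not contain $i$ immediately followed by $j$. There is an algorithm (a single program for a random access machine with unit-cost instructions, all of whose stored values are $O(n^2)$, so that words have $O(\log n)$ bits) which, given the adjacency matrix of a graph $G$ on $n\ge 1$ vertices and an $\{I_3,J_4,Q_4\}$-free labeling of $G$, computes in $O(n^2)$ steps a $12$-representant of $G$ with respect to this same labeling (without relabeling); in particular every such $G$ is $12$-representable. Moreover, for the computed word $w$ there is a simple-triangle model of the complement $\overline{G}$, that is, a family of triangles $T_v$, each spanned by a point on a horizontal line $L_1$ and an interval on a horizontal line $L_2$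 below $L_1$, such that distinct $u,v$ are adjacent in $\overline{G}$ if and only if $T_u\cap T_v\neq\emptyset$, in which the left-to-right order of the points on $L_1$ agrees with the labeling, the endpoints of the intervals on $L_2$ are pairwise distinct, and $w$ lists the labels of the owners of these endpoints from right to left. -/

import Mathlib

/-! ### Words -/

/-- The reduced form of a word: each occurrence of the `i`-th smallest letter becomes `i`
(the rank of a letter `a` is the number of distinct letters of the word that are `≤ a`). -/
def redWord (w : List ℕ) : List ℕ :=
  w.map fun a => (w.toFinset.filter (· ≤ a)).card

/-- `w` has a `u`-match: some factor of consecutive letters of `w` has reduced form `u`. -/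
def HasMatch (u w : List ℕ) : Prop :=
  ∃ i, i + u.length ≤ w.length ∧ redWord ((w.drop i).take u.length) = u

/-- The word `w_B`: all letters outside `B` are removed. -/
def restrictWord (w : List ℕ) (B : Finset ℕ) : List ℕ :=
  w.filter fun a => a ∈ B

/-! ### Labeled graphs -/

/-- A labeling of the vertices: distinct labels from `[n]`, where `n` is the number of vertices. -/
def IsLabeling {V : Type*} [Fintype V] (lab : V → ℕ) : Prop :=
  Function.Injective lab ∧ ∀ v, lab v ∈ Finset.Icc 1 (Fintype.card V)

/-- `w` is a `u`-representant of the graph `G` labeled by `lab`. -/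
def IsRepresentant {V : Type*} [Fintype V] (u : List ℕ) (G : SimpleGraph V) (lab : V → ℕ)
    (w : List ℕ) : Prop :=
  w.toFinset = Finset.Icc 1 (Fintype.card V) ∧
    ∀ x y : V, x ≠ y → (G.Adj x y ↔ ¬ HasMatch u (restrictWord w {lab x, lab y}))

/-- A labeled graph in reduced form on `k` vertices is a graph on `Fin k`, where the vertex `i`
carries the label `i + 1`. The labeled graph `(G, lab)` contains `F` if some induced subgraph of
`G` has reduced form `F`, i.e. there are `k` vertices which, listed by increasing label, induce
exactly the graph `F`. -/
def ContainsReduced {V : Type*} (G : SimpleGraph V) (lab : V → ℕ) {k : ℕ}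
    (F : SimpleGraph (Fin k)) : Prop :=
  ∃ f : Fin k → V, StrictMono (fun i => lab (f i)) ∧ ∀ i j, G.Adj (f i) (f j) ↔ F.Adj i j

/-- The labeling `lab` of `G` is `𝓕`-free, for a set `𝓕` of reduced labeled graphs. -/
def IsFreeLabeling {V : Type*} (𝓕 : Set (Σ k : ℕ, SimpleGraph (Fin k)))
    (G : SimpleGraph V) (lab : V → ℕ) : Prop :=
  ∀ F ∈ 𝓕, ¬ ContainsReduced G lab F.2

/-- The path with edges `12`, `23` (labels `1, 2, 3` are the elements `0, 1, 2` of `Fin 3`). -/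
def graphI3 : SimpleGraph (Fin 3) := SimpleGraph.fromEdgeSet {s(0, 1), s(1, 2)}

/-- Two disjoint edges `13`, `24`. -/
def graphJ4 : SimpleGraph (Fin 4) := SimpleGraph.fromEdgeSet {s(0, 2), s(1, 3)}

/-- Two disjoint edges `14`, `23`. -/
def graphQ4 : SimpleGraph (Fin 4) := SimpleGraph.fromEdgeSet {s(0, 3), s(1, 2)}

/-! ### Simple-triangle models -/

/-- The triangle with apex `(p, 1)` on the line `L₁ : y = 1` and with the interval `[l, r]` on the
line `L₂ : y = 0` as its base. -/
def triangle (p l r : ℝ) : Set (ℝ × ℝ) :=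
  convexHull ℝ {(p, 1), (l, 0), (r, 0)}

/-- A simple-triangle model of the graph `H`. -/
structure SimpleTriangleModel {V : Type*} (H : SimpleGraph V) where
  /-- the point on `L₁` -/
  point : V → ℝ
  /-- the left endpoint of the interval on `L₂` -/
  left : V → ℝ
  /-- the right endpoint of the interval on `L₂` -/
  right : V → ℝ
  left_lt_right : ∀ v, left v < right v
  adj_iff : ∀ u v, u ≠ v →
    (H.Adj u v ↔
      (triangle (point u) (left u) (right u) ∩ triangle (point v) (left v) (right v)).Nonempty)

/-- The order of the points on `L₁` agrees with the labeling. -/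
def SimpleTriangleModel.OrderedBy {V : Type*} {H : SimpleGraph V} (M : SimpleTriangleModel H)
    (lab : V → ℕ) : Prop :=
  ∀ u v, lab u < lab v → M.point u < M.point v

/-- All endpoints of the intervals on `L₂` are distinct, and `w` lists the labels of their owners
from right to left. Here `Sum.inl v` stands for the left and `Sum.inr v` for the right endpoint
of the interval of `v`. -/
def SimpleTriangleModel.IsRightToLeftReading {V : Type*} {H : SimpleGraph V}
    (M : SimpleTriangleModel H) (lab : V → ℕ) (w : List ℕ) : Prop :=
  ∃ e : Fin w.length ≃ V ⊕ V,
    StrictAnti (fun k => Sum.elim M.left M.right (e k)) ∧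
      ∀ k, w.get k = Sum.elim lab lab (e k)

/-! ### Random access machines -/

namespace RAM

/-- A memory state: registers (addressed by the constants in the program) and an array of memory
cells (addressed indirectly, through the contents of registers). -/
structure State where
  reg : ℕ → ℕ
  mem : ℕ → ℕ

/-- Elementary instructions. -/
inductive Op where
  /-- `R_d := c` -/
  | const (d c : ℕ)
  /-- `R_d := R_a` -/
  | move (d a : ℕ)
  /-- `R_d := R_a + R_b` -/
  | add (d a b : ℕ)
  /-- `R_d := max (R_a - R_b) 0` -/
  | sub (d a b : ℕ)
  /-- `R_d := R_a * R_b` -/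
  | mul (d a b : ℕ)
  /-- `R_d := M[R_a]` -/
  | load (d a : ℕ)
  /-- `M[R_a] := R_b` -/
  | store (a b : ℕ)

/-- The value that an instruction writes. -/
def Op.value (s : State) : Op → ℕ
  | .const _ c => c
  | .move _ a => s.reg a
  | .add _ a b => s.reg a + s.reg b
  | .sub _ a b => s.reg a - s.reg b
  | .mul _ a b => s.reg a * s.reg b
  | .load _ a => s.mem (s.reg a)
  | .store _ b => s.reg b

/-- Write the value `x` into the register `d`. -/
def State.setReg (s : State) (d x : ℕ) : State :=
  { s with reg := Function.update s.reg d x }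

/-- Write the value `x` into the memory cell `a`. -/
def State.setMem (s : State) (a x : ℕ) : State :=
  { s with mem := Function.update s.mem a x }

/-- The state after an instruction. -/
def Op.apply (s : State) (o : Op) : State :=
  match o with
  | .const d _ => s.setReg d (o.value s)
  | .move d _ => s.setReg d (o.value s)
  | .add d _ _ => s.setReg d (o.value s)
  | .sub d _ _ => s.setReg d (o.value s)
  | .mul d _ _ => s.setReg d (o.value s)
  | .load d _ => s.setReg d (o.value s)
  | .store a _ => s.setMem (s.reg a) (o.value s)

/-- Programs. All tests compare two registers: `R_a < R_b`. -/
inductive Prog where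
  | skip
  | op (o : Op)
  | seq (p q : Prog)
  | ifLt (a b : ℕ) (p q : Prog)
  | whileLt (a b : ℕ) (p : Prog)

/-- `Exec B p s s' t`: started in the state `s`, the program `p` halts in the state `s'` after `t`
steps, and no value greater than `B` is ever written. Every elementary instruction and every
evaluation of a test costs one step. -/
inductive Exec (B : ℕ) : Prog → State → State → ℕ → Prop
  | skip (s : State) : Exec B .skip s s 1
  | op (o : Op) (s : State) (h : o.value s ≤ B) : Exec B (.op o) s (o.apply s) 1
  | seq {p q : Prog} {s s' s'' : State} {t t' : ℕ}
      (hp : Exec B p s s' t) (hq : Exec B q s' s'' t') : Exec B (.seq p q) s s'' (t + t')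
  | ifTrue {a b : ℕ} {p q : Prog} {s s' : State} {t : ℕ}
      (h : s.reg a < s.reg b) (hp : Exec B p s s' t) : Exec B (.ifLt a b p q) s s' (t + 1)
  | ifFalse {a b : ℕ} {p q : Prog} {s s' : State} {t : ℕ}
      (h : ¬ s.reg a < s.reg b) (hq : Exec B q s s' t) : Exec B (.ifLt a b p q) s s' (t + 1)
  | whileFalse {a b : ℕ} {p : Prog} {s : State}
      (h : ¬ s.reg a < s.reg b) : Exec B (.whileLt a b p) s s 1
  | whileTrue {a b : ℕ} {p : Prog} {s s' s'' : State} {t t' : ℕ}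
      (h : s.reg a < s.reg b) (hp : Exec B p s s' t)
      (hw : Exec B (.whileLt a b p) s' s'' t') : Exec B (.whileLt a b p) s s'' (t + t' + 1)

open Classical in
/-- The input: `R_0 = n`; the cells `0, …, n² - 1` hold the adjacency matrix of `G`, row by row;
the cells `n², …, n² + n - 1` hold the labels of the vertices; everything else is `0`. -/
noncomputable def inputState {n : ℕ} (G : SimpleGraph (Fin n)) (lab : Fin n → ℕ) : State where
  reg r := if r = 0 then n else 0
  mem a :=
    if h : a < n * n then
      if G.Adj ⟨a / n, Nat.div_lt_of_lt_mul h⟩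
          ⟨a % n, Nat.mod_lt a (Nat.pos_of_lt_mul_left h)⟩ then 1 else 0
    else if h : a - n * n < n then lab ⟨a - n * n, h⟩ else 0

/-- The output word: its letters are in `R_1` consecutive cells, starting at the address `R_0`. -/
def State.output (s : State) : List ℕ :=
  (List.range (s.reg 1)).map fun k => s.mem (s.reg 0 + k)

end RAM

/-!
Number the vertices `0, …, n - 1` by their labels and write `A i j` for adjacency. In a
simple-triangle model of the complement whose points are ordered by the labels, the triangles of
`i < j` are disjoint exactly if the right endpoint of `i` lies to the left of the left endpoint of
`j` (`triangle_inter_nonempty_iff`); a list of all endpoints from right to left then spells a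
`12`-representant (`isRepresentant_of_sorted`). So the task is to order `2 n` endpoints such that
`right i < left j ↔ A i j` for `i < j`, and `left i < right i`.

The left endpoints are ordered first. For `a < b`, the lower neighbourhoods of `a` and `b` within
`{0, …, a}` are nested, because the labeling is free (`Admissible.nested`), and `left a` has to
precede `left b` if that of `b` is strictly larger. If the two neighbourhoods of `a < b` agree,
`left b` is put first. The resulting tournament `Prec` has no three-cycle
(`Admissible.no_cycle_of_min`), so it is a linear order, and `rank` is the position in it. The
endpoint `right i` goes directly after the last `left k` with `k ≥ i` and `¬ A i k`, whose rank is
`reach i`; `Admissible.adj_iff_reach_lt_rank` says that this is right.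

Nestedness also makes the order cheap to compute: neighbourhoods are compared by cardinality, and
the `n ^ 2` cardinalities `#{m ≤ i | A m j}` are partial sums along the columns of the adjacency
matrix. The program tabulates the inverse of the labeling, these cardinalities, the ranks and the reaches,
and lists, for `p = n - 1, …, 0`, the right endpoints of reach `p` and the left endpoint of rank
`p`. Each of these steps is one nest of two loops of length `n` (`run_nest`).
-/

/-! ### A linear order on the left endpoints -/

/-- A relation on `{0, …, n - 1}`, read as a graph whose vertices are numbered by their labels, that
has none of the three forbidden patterns: `trans` excludes `I₃`, and `cross`, given `trans`,
excludes `J₄` and `Q₄`. -/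
structure Admissible (n : ℕ) (A : ℕ → ℕ → Prop) : Prop where
  irrefl : ∀ i, ¬ A i i
  trans : ∀ i j k, i < j → j < k → k < n → A i j → A j k → A i k
  cross : ∀ i j k m, i < j → i < m → k < j → k < m → j < n → m < n →
    A i j → A k m → A i m ∨ A k j

open Classical in
/-- The vertices `m ≤ i` adjacent to `j`. -/
noncomputable def lowerNbrs (A : ℕ → ℕ → Prop) (j i : ℕ) : Finset ℕ :=
  (Finset.range (i + 1)).filter (A · j)

theorem mem_lowerNbrs {A : ℕ → ℕ → Prop} {j i m : ℕ} :
    m ∈ lowerNbrs A j i ↔ m ≤ i ∧ A m j := by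
  classical
  simp [lowerNbrs]

/-- The left endpoint of `a` has to lie to the left of that of `b`, or this choice is made for want
of a constraint. The constraint is that some `m ≤ min a b` is adjacent to `b` and not to `a`; by
nestedness of the neighbourhoods it is a comparison of cardinalities. Unconstrained pairs are
ordered by decreasing label. -/
def Prec (A : ℕ → ℕ → Prop) (a b : ℕ) : Prop :=
  if a < b then (lowerNbrs A a a).card < (lowerNbrs A b a).card
  else b < a ∧ ¬ (lowerNbrs A b b).card < (lowerNbrs A a b).card

open Classical in
/-- The position of the left endpoint of `b` among all left endpoints. -/
noncomputable def rank (n : ℕ) (A : ℕ → ℕ → Prop) (b : ℕ) : ℕ :=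
  ((Finset.range n).filter (Prec A · b)).card

open Classical in
/-- The largest position of a left endpoint that has to lie to the left of the right endpoint
of `i`. -/
noncomputable def reach (n : ℕ) (A : ℕ → ℕ → Prop) (i : ℕ) : ℕ :=
  ((Finset.range n).filter fun k => i ≤ k ∧ ¬ A i k).sup (rank n A)

section Order

variable {n : ℕ} {A : ℕ → ℕ → Prop}

theorem Admissible.nested (hA : Admissible n A) {a b : ℕ} (hab : a < b) (hb : b < n) :
    lowerNbrs A a a ⊆ lowerNbrs A b a ∨ lowerNbrs A b a ⊆ lowerNbrs A a a := by
  by_contra! h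
  obtain ⟨h1, h2⟩ := h
  obtain ⟨m, hm, hm'⟩ := Finset.not_subset.1 h1
  obtain ⟨k, hk, hk'⟩ := Finset.not_subset.1 h2
  simp only [mem_lowerNbrs, not_and] at hm hm' hk hk'
  have hma : m ≠ a := fun h => hA.irrefl a (h ▸ hm.2)
  have hm'' := hm' hm.1
  have hk'' := hk' hk.1
  rcases eq_or_lt_of_le hk.1 with rfl | hka
  · exact hm'' (hA.trans _ _ _ (by omega) hab hb hm.2 hk.2)
  · rcases hA.cross m a k b (by omega) (by omega) hka (by omega) (by omega) hb hm.2 hk.2 with h | h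
    · exact hm'' h
    · exact hk'' h

theorem Admissible.card_lt_iff (hA : Admissible n A) {a b : ℕ} (hab : a < b) (hb : b < n) :
    (lowerNbrs A a a).card < (lowerNbrs A b a).card ↔ ∃ m ≤ a, A m b ∧ ¬ A m a := by
  constructor
  · intro h
    have : ¬ lowerNbrs A b a ⊆ lowerNbrs A a a := fun h' =>
      absurd (Finset.card_le_card h') (by omega)
    obtain ⟨k, hk, hk'⟩ := Finset.not_subset.1 this
    simp only [mem_lowerNbrs, not_and] at hk hk'
    exact ⟨k, hk.1, hk.2, hk' hk.1⟩
  · rintro ⟨m, hm, h1, h2⟩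
    have hmb : m ∈ lowerNbrs A b a := mem_lowerNbrs.2 ⟨hm, h1⟩
    have hma : m ∉ lowerNbrs A a a := fun h => h2 (mem_lowerNbrs.1 h).2
    rcases hA.nested hab hb with h | h
    · exact Finset.card_lt_card ⟨h, fun h' => hma (h' hmb)⟩
    · exact absurd (h hmb) hma

theorem not_prec_self (a : ℕ) : ¬ Prec A a a := by simp [Prec]

theorem prec_or_prec {a b : ℕ} (hab : a ≠ b) : Prec A a b ∨ Prec A b a := by
  unfold Prec
  rcases lt_or_gt_of_ne hab with h | h <;> simp [h, h.not_gt] <;> omega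

/-- A single `m ≤ min a b` that is adjacent to exactly one of `a` and `b` decides their order. -/
theorem Admissible.prec_of_adj (hA : Admissible n A) {a b m : ℕ} (ha : a < n) (hb : b < n)
    (hma : m ≤ a) (hmb : m ≤ b) (h1 : A m b) (h2 : ¬ A m a) : Prec A a b := by
  unfold Prec
  split_ifs with hab
  · exact (hA.card_lt_iff hab hb).2 ⟨m, hma, h1, h2⟩
  · have hne : a ≠ b := fun h => h2 (h ▸ h1)
    have hba : b < a := by omega
    refine ⟨hba, fun h => ?_⟩
    rcases hA.nested hba ha with h' | h'
    · exact h2 (mem_lowerNbrs.1 (h' (mem_lowerNbrs.2 ⟨hmb, h1⟩))).2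
    · exact absurd (Finset.card_le_card h') (by omega)

theorem Admissible.adj_of_prec (hA : Admissible n A) {a b m : ℕ} (ha : a < n) (hb : b < n)
    (hma : m ≤ a) (hmb : m ≤ b) (h : Prec A a b) (h1 : A m a) : A m b := by
  unfold Prec at h
  split_ifs at h with hab
  · rcases hA.nested hab hb with h' | h'
    · exact (mem_lowerNbrs.1 (h' (mem_lowerNbrs.2 ⟨hma, h1⟩))).2
    · exact absurd (Finset.card_le_card h') (by omega)
  · by_contra h2
    exact h.2 ((hA.card_lt_iff h.1 ha).2 ⟨m, hmb, h1, h2⟩)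

/-- A vertex `m` that witnesses the first comparison `Prec A a b` at the smallest element `a` of a
three-cycle is passed on to `c`, and contradicts the last comparison. -/
theorem Admissible.no_cycle_of_min (hA : Admissible n A) {a b c : ℕ} (hb : b < n) (hc : c < n)
    (hab : a < b) (hac : a < c) (h1 : Prec A a b) (h2 : Prec A b c) (h3 : Prec A c a) : False := by
  rw [Prec, if_pos hab, hA.card_lt_iff hab hb] at h1
  obtain ⟨m, hm, hmb, hma⟩ := h1
  exact hma (hA.adj_of_prec hc (by omega) (by omega) hm h3
    (hA.adj_of_prec hb hc (by omega) (by omega) h2 hmb))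

theorem Admissible.prec_trans (hA : Admissible n A) {a b c : ℕ} (ha : a < n) (hb : b < n)
    (hc : c < n) (h1 : Prec A a b) (h2 : Prec A b c) : Prec A a c := by
  have hab : a ≠ b := fun h => not_prec_self b (h ▸ h1)
  have hbc : b ≠ c := fun h => not_prec_self c (h ▸ h2)
  have hac : a ≠ c := by
    rintro rfl
    unfold Prec at h1 h2
    rcases lt_or_gt_of_ne hab with h | h <;> simp [h, h.not_gt] at h1 h2 <;> omega
  by_contra h3
  have h3 := (prec_or_prec hac).resolve_left h3
  rcases lt_or_gt_of_ne hab with h | h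
  · rcases lt_or_gt_of_ne hac with h' | h'
    · exact hA.no_cycle_of_min hb hc h h' h1 h2 h3
    · exact hA.no_cycle_of_min ha hb h' (by omega) h3 h1 h2
  · rcases lt_or_gt_of_ne hbc with h' | h'
    · exact hA.no_cycle_of_min hc ha h' h h2 h3 h1
    · exact hA.no_cycle_of_min ha hb (by omega) h' h3 h1 h2

theorem Admissible.rank_lt_rank (hA : Admissible n A) {a b : ℕ} (ha : a < n) (hb : b < n)
    (h : Prec A a b) : rank n A a < rank n A b := by
  classical
  refine Finset.card_lt_card ⟨fun x hx => ?_, fun hs => ?_⟩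
  · simp only [Finset.mem_filter, Finset.mem_range] at hx ⊢
    exact ⟨hx.1, hA.prec_trans hx.1 ha hb hx.2 h⟩
  · have : a ∈ (Finset.range n).filter (Prec A · b) := by simp [ha, h]
    exact not_prec_self a (Finset.mem_filter.1 (hs this)).2

theorem rank_lt {b : ℕ} (hb : b < n) : rank n A b < n := by
  classical
  conv_rhs => rw [← Finset.card_range n]
  refine Finset.card_lt_card ⟨Finset.filter_subset _ _, fun h => ?_⟩
  exact not_prec_self b (Finset.mem_filter.1 (h (Finset.mem_range.2 hb))).2

theorem reach_lt {i : ℕ} (hi : i < n) : reach n A i < n := by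
  classical
  refine (Finset.sup_lt_iff (by simpa using by omega)).2 fun k hk => rank_lt ?_
  exact Finset.mem_range.1 (Finset.mem_filter.1 hk).1

theorem rank_le_reach {i k : ℕ} (hk : k < n) (hik : i ≤ k) (h : ¬ A i k) :
    rank n A k ≤ reach n A i := by
  classical
  exact Finset.le_sup (f := rank n A) (by simp [hk, hik, h])

theorem Admissible.adj_iff_reach_lt_rank (hA : Admissible n A) {i j : ℕ} (hij : i < j)
    (hj : j < n) : A i j ↔ reach n A i < rank n A j := by
  classical
  constructor
  · intro h
    -- the vertex `i` itself distinguishes `j` from its non-neighbours `k ≥ i`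
    have key : ∀ k, k < n → i ≤ k → ¬ A i k → rank n A k < rank n A j := fun k hk hik hn =>
      hA.rank_lt_rank hk hj (hA.prec_of_adj hk hj hik hij.le h hn)
    have h0 : ⊥ < rank n A j := bot_le.trans_lt (key i (hij.trans hj) le_rfl (hA.irrefl i))
    refine (Finset.sup_lt_iff h0).2 fun k hk => ?_
    simp only [Finset.mem_filter, Finset.mem_range] at hk
    exact key k hk.1 hk.2.1 hk.2.2
  · intro h
    by_contra hn
    exact absurd (rank_le_reach hj hij.le hn) (by omega)

end Order

/-! ### Triangles -/

theorem triangle_inter_nonempty_iff {p l r p' l' r' : ℝ} (hp : p < p') (h : l < r) (h' : l' < r') :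
    (triangle p l r ∩ triangle p' l' r').Nonempty ↔ l' ≤ r := by
  constructor
  · rintro ⟨z, hz, hz'⟩
    -- at each height the first triangle lies left of its right side, the second right of its left
    have h1 : z ∈ {z : ℝ × ℝ | z.1 ≤ p * z.2 + r * (1 - z.2) ∧ 0 ≤ z.2 ∧ z.2 ≤ 1} := by
      refine convexHull_min ?_ ?_ hz
      · rintro x (rfl | rfl | rfl) <;> simp [h.le]
      · rintro x ⟨hx, hx0, hx1⟩ y ⟨hy, hy0, hy1⟩ a b ha hb hab
        obtain rfl : b = 1 - a := by linarith
        simp only [Set.mem_ofPred_eq, Prod.fst_add, Prod.smul_fst, Prod.snd_add, Prod.smul_snd,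
          smul_eq_mul]
        refine ⟨?_, by positivity, ?_⟩
        · linarith [mul_le_mul_of_nonneg_left hx ha, mul_le_mul_of_nonneg_left hy hb]
        · linarith [mul_le_mul_of_nonneg_left hx1 ha, mul_le_mul_of_nonneg_left hy1 hb]
    have h2 : z ∈ {z : ℝ × ℝ | p' * z.2 + l' * (1 - z.2) ≤ z.1} := by
      refine convexHull_min ?_ ?_ hz'
      · rintro x (rfl | rfl | rfl) <;> simp [h'.le]
      · rintro x hx y hy a b ha hb hab
        obtain rfl : b = 1 - a := by linarith
        simp only [Set.mem_ofPred_eq, Prod.fst_add, Prod.smul_fst, Prod.snd_add, Prod.smul_snd,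
          smul_eq_mul] at hx hy ⊢
        linarith [mul_le_mul_of_nonneg_left hx ha, mul_le_mul_of_nonneg_left hy hb]
    obtain ⟨h1, h0, h01⟩ := h1
    simp only [Set.mem_ofPred_eq] at h2
    by_contra! hlt
    rcases h0.eq_or_lt with h0 | h0
    · rw [← h0] at h1 h2
      linarith
    · linarith [mul_lt_mul_of_pos_right hp h0,
        mul_le_mul_of_nonneg_right hlt.le (sub_nonneg.2 h01)]
  · intro hlr
    -- the right side of the first triangle crosses the left side of the second at height `t`
    have hd : 0 < (p' - p) + (r - l') := by linarith
    set t := (r - l') / ((p' - p) + (r - l')) with ht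
    have ht0 : 0 ≤ t := div_nonneg (by linarith) hd.le
    have ht1 : t ≤ 1 := (div_le_one hd).2 (by linarith)
    have hx : t * p + (1 - t) * r = t * p' + (1 - t) * l' := by
      rw [ht]; field_simp; ring
    refine ⟨(t * p + (1 - t) * r, t), ?_, ?_⟩
    · refine segment_subset_convexHull (x := (p, 1)) (y := (r, 0)) (by simp) (by simp) ?_
      exact ⟨t, 1 - t, ht0, by linarith, by ring, by ext <;> simp⟩
    · refine segment_subset_convexHull (x := (p', 1)) (y := (l', 0)) (by simp) (by simp) ?_
      exact ⟨t, 1 - t, ht0, by linarith, by ring, by ext <;> simp [hx]⟩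

/-! ### Words read off from a list of endpoints -/

theorem redWord_pair_eq_iff (a b : ℕ) : redWord [a, b] = [1, 2] ↔ a < b := by
  rcases lt_trichotomy a b with h | rfl | h
  · have : ({a, b} : Finset ℕ).filter (· ≤ a) = {a} := by ext; simp; omega
    have h2 : ({a, b} : Finset ℕ).filter (· ≤ b) = {a, b} := by ext; simp; omega
    simp [redWord, this, h2, h, h.ne]
  · simp [redWord, Finset.filter_singleton]
  · have : ({a, b} : Finset ℕ).filter (· ≤ b) = {b} := by ext; simp; omega
    simp [redWord, this, h.not_gt]

/-- A word avoids a consecutive ascent iff it is weakly decreasing. -/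
theorem not_hasMatch_iff_pairwise (u : List ℕ) : ¬ HasMatch [1, 2] u ↔ u.Pairwise (· ≥ ·) := by
  rw [← List.isChain_iff_pairwise, List.isChain_iff_getElem, HasMatch, not_exists]
  refine forall_congr' fun i => ?_
  rw [not_and]
  refine forall_congr' fun hi => ?_
  have hi' : i + 1 < u.length := by simp at hi; omega
  have : (u.drop i).take 2 = [u[i], u[i + 1]] := by
    rw [List.drop_eq_getElem_cons (by omega), List.drop_eq_getElem_cons hi']
    rfl
  simp only [List.length_cons, List.length_nil, zero_add, Nat.reduceAdd]
  rw [this, redWord_pair_eq_iff, not_lt]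

/-- For a strictly sorted list, positions can be compared by keys. -/
theorem pairwise_iff_of_sorted {α : Type*} {E : List α} {key : α → ℕ}
    (hE : E.Pairwise (fun a b => key b < key a)) (R : α → α → Prop) :
    E.Pairwise R ↔ ∀ a ∈ E, ∀ b ∈ E, key b < key a → R a b := by
  induction E with
  | nil => simp
  | cons x E ih =>
    rw [List.pairwise_cons] at hE ⊢
    rw [ih hE.2]
    constructor
    · rintro ⟨h1, h2⟩ a ha b hb hab
      rcases List.mem_cons.1 ha with rfl | ha'
      · rcases List.mem_cons.1 hb with rfl | hb
        · omega
        · exact h1 b hb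
      · rcases List.mem_cons.1 hb with rfl | hb'
        · have := hE.1 a ha'
          omega
        · exact h2 a ha' b hb' hab
    · exact fun h => ⟨fun b hb => h x (by simp) b (by simp [hb]) (hE.1 b hb),
        fun a ha b hb => h a (by simp [ha]) b (by simp [hb])⟩

section Words

variable {V : Type*} [Fintype V] {lab : V → ℕ} {left right : V → ℕ} {E : List (V ⊕ V)}

/-- A list of all endpoints, sorted from right to left, spells a `12`-representant of the graph in
which `x` and `y` with `lab x < lab y` are adjacent when the interval of `x` lies to the left of
that of `y`. -/
theorem isRepresentant_of_sorted (G : SimpleGraph V) (hlab : IsLabeling lab)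
    (hlr : ∀ v, left v < right v)
    (hG : ∀ x y, lab x < lab y → (G.Adj x y ↔ right x < left y))
    (hE : E.Pairwise fun a b => Sum.elim left right b < Sum.elim left right a)
    (hmem : ∀ a, a ∈ E) :
    IsRepresentant [1, 2] G lab (E.map (Sum.elim lab lab)) := by
  refine ⟨?_, ?_⟩
  · have himg : Finset.univ.image lab = Finset.Icc 1 (Fintype.card V) := by
      refine Finset.eq_of_subset_of_card_le ?_ ?_
      · intro a ha
        obtain ⟨v, -, rfl⟩ := Finset.mem_image.1 ha
        exact hlab.2 v
      · rw [Finset.card_image_of_injective _ hlab.1]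
        simp
    rw [← himg]
    ext a
    simp only [List.mem_toFinset, List.mem_map, hmem, true_and, Finset.mem_image,
      Finset.mem_univ, Sum.exists, Sum.elim_inl, Sum.elim_inr, or_self]
  · have key : ∀ x y : V, lab x < lab y →
        (G.Adj x y ↔ ¬ HasMatch [1, 2]
          (restrictWord (E.map (Sum.elim lab lab)) {lab x, lab y})) := by
      intro x y hxy
      rw [hG x y hxy, not_hasMatch_iff_pairwise, restrictWord, List.pairwise_filter,
        List.pairwise_map, pairwise_iff_of_sorted hE]
      simp only [hmem, true_implies, Finset.mem_insert, Finset.mem_singleton, decide_eq_true_eq]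
      constructor
      · intro h
        have hval : ∀ a v, Sum.elim lab lab a = lab v →
            left v ≤ Sum.elim left right a ∧ Sum.elim left right a ≤ right v := by
          rintro (u | u) v huv <;> obtain rfl := hlab.1 huv <;> simp [(hlr u).le]
        rintro a b hab (ha | ha) (hb | hb)
        · omega
        · have := hval a _ ha
          have := hval b _ hb
          omega
        · omega
        · omega
      · intro h
        by_contra hlt
        have hne : right x ≠ left y := by
          intro heq
          -- two different members of a strictly sorted list have different keys
          have hinj : (E.map (Sum.elim left right)).Nodup := by
            rw [List.nodup_iff_pairwise_ne, List.pairwise_map]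
            exact hE.imp fun h => h.ne'
          have := List.inj_on_of_nodup_map hinj (hmem (.inr x)) (hmem (.inl y)) (by simpa using heq)
          simp at this
        have := h (.inr x) (.inl y) (by simp; omega) (by simp) (by simp)
        simp only [Sum.elim_inr, Sum.elim_inl] at this
        omega
    intro x y hxy
    rcases lt_or_gt_of_ne (hlab.1.ne hxy) with h | h
    · exact key x y h
    · rw [SimpleGraph.adj_comm, Finset.pair_comm]
      exact key y x h

/-- The intervals on `L₂` and the labels as points on `L₁` give a model of the complement. -/
theorem exists_model_of_sorted (G : SimpleGraph V) (hlab : IsLabeling lab)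
    (hlr : ∀ v, left v < right v)
    (hG : ∀ x y, lab x < lab y → (G.Adj x y ↔ right x < left y))
    (hE : E.Pairwise fun a b => Sum.elim left right b < Sum.elim left right a)
    (hmem : ∀ a, a ∈ E) :
    ∃ M : SimpleTriangleModel Gᶜ, M.OrderedBy lab ∧
      M.IsRightToLeftReading lab (E.map (Sum.elim lab lab)) := by
  classical
  have key : ∀ u v : V, lab u < lab v → (Gᶜ.Adj u v ↔
      (triangle (lab u) (left u) (right u) ∩ triangle (lab v) (left v) (right v)).Nonempty) := by
    intro u v huv
    have hne : u ≠ v := fun h => by simp [h] at huv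
    rw [triangle_inter_nonempty_iff (by exact_mod_cast huv) (by exact_mod_cast hlr u)
      (by exact_mod_cast hlr v), Nat.cast_le, SimpleGraph.compl_adj, hG u v huv]
    simp [hne]
  refine ⟨⟨fun v => lab v, fun v => left v, fun v => right v, fun v => by exact_mod_cast hlr v,
    fun u v huv => ?_⟩, fun u v h => Nat.cast_lt.2 h, ?_⟩
  · rcases lt_or_gt_of_ne (hlab.1.ne huv) with h | h
    · exact key u v h
    · rw [SimpleGraph.adj_comm, Set.inter_comm]
      exact key v u h
  · have hnd : E.Nodup := hE.imp fun h heq => by simp [heq] at h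
    refine ⟨(finCongr (by simp)).trans (hnd.getEquivOfForallMemList E hmem), ?_, ?_⟩
    · have hcast : ∀ a : V ⊕ V, Sum.elim (fun v => (left v : ℝ)) (fun v => (right v : ℝ)) a =
          ((Sum.elim left right a : ℕ) : ℝ) := by rintro (v | v) <;> rfl
      intro i j hij
      simp only [hcast]
      refine Nat.cast_lt.2 ?_
      exact List.pairwise_iff_getElem.1 hE i j (by simpa using i.2) (by simpa using j.2) hij
    · intro k
      simp

end Words

/-! ### From free labelings to intervals -/

section Labels

variable {n : ℕ} {G : SimpleGraph (Fin n)} {lab : Fin n → ℕ} {vert : ℕ → Fin n}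

/-- The inverse of the labeling, for labels counted from `0` and with arbitrary values beyond. -/
theorem IsLabeling.exists_vert (hlab : IsLabeling lab) (hn : 1 ≤ n) :
    ∃ vert : ℕ → Fin n, ∀ i < n, lab (vert i) = i + 1 := by
  have hsurj : Function.Surjective
      (fun v => (⟨lab v - 1, by have := hlab.2 v; simp at this; omega⟩ : Fin n)) := by
    refine Finite.surjective_of_injective fun u v huv => hlab.1 ?_
    have hu := hlab.2 u
    have hv := hlab.2 v
    simp only [Fin.mk.injEq, Finset.mem_Icc] at huv hu hv
    omega
  have : ∀ i, ∃ v : Fin n, i < n → lab v = i + 1 := fun i => by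
    by_cases hi : i < n
    · obtain ⟨v, hv⟩ := hsurj ⟨i, hi⟩
      have := hlab.2 v
      simp only [Fin.mk.injEq, Finset.mem_Icc] at hv this
      exact ⟨v, fun _ => by omega⟩
    · exact ⟨⟨0, hn⟩, fun h => absurd h hi⟩
  choose vert hvert using this
  exact ⟨vert, hvert⟩

theorem IsLabeling.vert_lab_sub_one (hlab : IsLabeling lab) (hvert : ∀ i < n, lab (vert i) = i + 1)
    (v : Fin n) : lab v - 1 < n ∧ lab v - 1 + 1 = lab v ∧ vert (lab v - 1) = v := by
  have := hlab.2 v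
  simp only [Finset.mem_Icc, Fintype.card_fin] at this
  refine ⟨by omega, by omega, hlab.1 ?_⟩
  rw [hvert _ (by omega)]
  omega

theorem admissible_of_isFreeLabeling (hvert : ∀ i < n, lab (vert i) = i + 1)
    (hG : IsFreeLabeling {⟨3, graphI3⟩, ⟨4, graphJ4⟩, ⟨4, graphQ4⟩} G lab) :
    Admissible n fun i j => G.Adj (vert i) (vert j) := by
  have hI := hG ⟨3, graphI3⟩ (by simp)
  have hJ := hG ⟨4, graphJ4⟩ (by simp)
  have hQ := hG ⟨4, graphQ4⟩ (by simp)
  have htrans : ∀ i j k, i < j → j < k → k < n → G.Adj (vert i) (vert j) →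
      G.Adj (vert j) (vert k) → G.Adj (vert i) (vert k) := by
    intro i j k hij hjk hk h1 h2
    by_contra h3
    refine hI ⟨![vert i, vert j, vert k], ?_, ?_⟩
    · rw [Fin.strictMono_iff_lt_succ]
      simp [Fin.forall_fin_succ, hvert i (by omega), hvert j (by omega), hvert k hk, hij, hjk]
    · simp [Fin.forall_fin_succ, graphI3, h1, h1.symm, h2, h2.symm, h3, G.adj_comm (vert k)]
  have hnJ : ∀ a b c d, a < b → b < c → c < d → d < n → G.Adj (vert a) (vert c) →
      G.Adj (vert b) (vert d) → ¬ G.Adj (vert a) (vert b) → ¬ G.Adj (vert a) (vert d) →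
      ¬ G.Adj (vert b) (vert c) → ¬ G.Adj (vert c) (vert d) → False := by
    intro a b c d hab hbc hcd hd h1 h2 h3 h4 h5 h6
    refine hJ ⟨![vert a, vert b, vert c, vert d], ?_, ?_⟩
    · rw [Fin.strictMono_iff_lt_succ]
      simp [Fin.forall_fin_succ, hvert a (by omega), hvert b (by omega), hvert c (by omega),
        hvert d hd, hab, hbc, hcd]
    · simp [Fin.forall_fin_succ, graphJ4, h1, h1.symm, h2, h2.symm, h3, h4, h5, h6,
        G.adj_comm (vert d), G.adj_comm (vert c), G.adj_comm (vert b) (vert a)]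
  have hnQ : ∀ a b c d, a < b → b < c → c < d → d < n → G.Adj (vert a) (vert d) →
      G.Adj (vert b) (vert c) → ¬ G.Adj (vert a) (vert b) → ¬ G.Adj (vert a) (vert c) →
      ¬ G.Adj (vert b) (vert d) → ¬ G.Adj (vert c) (vert d) → False := by
    intro a b c d hab hbc hcd hd h1 h2 h3 h4 h5 h6
    refine hQ ⟨![vert a, vert b, vert c, vert d], ?_, ?_⟩
    · rw [Fin.strictMono_iff_lt_succ]
      simp [Fin.forall_fin_succ, hvert a (by omega), hvert b (by omega), hvert c (by omega),
        hvert d hd, hab, hbc, hcd]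
    · simp [Fin.forall_fin_succ, graphQ4, h1, h1.symm, h2, h2.symm, h3, h4, h5, h6,
        G.adj_comm (vert d), G.adj_comm (vert c), G.adj_comm (vert b) (vert a)]
  refine ⟨fun i => G.irrefl, htrans, ?_⟩
  intro i j k m hij him hkj hkm hj hm h1 h2
  by_contra! h
  obtain ⟨h3, h4⟩ := h
  -- by transitivity there are no edges inside `{i, k}` and inside `{j, m}`
  have hik : i < k → ¬ G.Adj (vert i) (vert k) := fun hlt h => h3 (htrans i k m hlt hkm hm h h2)
  have hki : k < i → ¬ G.Adj (vert k) (vert i) := fun hlt h => h4 (htrans k i j hlt hij hj h h1)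
  have hjm : j < m → ¬ G.Adj (vert j) (vert m) := fun hlt h => h3 (htrans i j m hij hlt hm h1 h)
  have hmj : m < j → ¬ G.Adj (vert m) (vert j) := fun hlt h => h4 (htrans k m j hkm hlt hj h2 h)
  have hne : i ≠ k := fun h => h4 (h ▸ h1)
  have hne' : j ≠ m := fun h => h3 (h ▸ h1)
  rcases lt_or_gt_of_ne hne with h | h <;> rcases lt_or_gt_of_ne hne' with h' | h'
  · exact hnJ i k j m h hkj h' hm h1 h2 (hik h) h3 h4 (hjm h')
  · exact hnQ i k m j h hkm h' hj h1 h2 (hik h) h3 h4 (hmj h')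
  · exact hnQ k i j m h hij h' hm h2 h1 (hki h) h4 h3 (hjm h')
  · exact hnJ k i m j h him h' hj h2 h1 (hki h) h4 h3 (hmj h')

end Labels

/-- The coordinate of the left endpoint of the `i`-th interval: `rank`, scaled to leave room for the
right endpoints. The summand `n - 1 - i` makes all coordinates distinct, without appeal to the
injectivity of `rank`, and follows the order in which the loops of the program list the letters. -/
noncomputable def leftKey (n : ℕ) (A : ℕ → ℕ → Prop) (i : ℕ) : ℕ :=
  2 * rank n A i * n + (n - 1 - i)

/-- The coordinate of the right endpoint of the `i`-th interval: after all left endpoints of rank at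
most `reach`, ties broken by `i`. -/
noncomputable def rightKey (n : ℕ) (A : ℕ → ℕ → Prop) (i : ℕ) : ℕ :=
  (2 * reach n A i + 1) * n + (n - 1 - i)

theorem mul_add_lt_mul_add {a b n x y : ℕ} (h : a < b) (hx : x < n) : a * n + x < b * n + y := by
  nlinarith [Nat.mul_le_mul_right n h]

/-- The part `p` of the word: the labels of the right endpoints with `reach` equal to `p`, and then
that of the left endpoint of rank `p`. The label of the vertex number `i` is `i + 1`. -/
noncomputable def wordPart (n : ℕ) (A : ℕ → ℕ → Prop) (p : ℕ) : List ℕ :=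
  ((List.range n).filter (reach n A · = p)).map (· + 1) ++
    ((List.range n).filter (rank n A · = p)).map (· + 1)

/-- The labels of the owners of all endpoints from right to left. -/
noncomputable def endpointWord (n : ℕ) (A : ℕ → ℕ → Prop) : List ℕ :=
  (List.range n).flatMap fun q => wordPart n A (n - 1 - q)

section Endpoints

variable {n : ℕ} {lab : Fin n → ℕ} {vert : ℕ → Fin n}

/-- The endpoints themselves, in the order in which `endpointWord` lists the labels of their
owners. -/
noncomputable def endpoints (n : ℕ) (A : ℕ → ℕ → Prop) (vert : ℕ → Fin n) :
    List (Fin n ⊕ Fin n) :=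
  (List.range n).flatMap fun q =>
    ((List.range n).filter (reach n A · = n - 1 - q)).map (Sum.inr ∘ vert) ++
      ((List.range n).filter (rank n A · = n - 1 - q)).map (Sum.inl ∘ vert)

theorem map_endpoints (A : ℕ → ℕ → Prop) (hvert : ∀ i < n, lab (vert i) = i + 1) :
    (endpoints n A vert).map (Sum.elim lab lab) = endpointWord n A := by
  have h : ∀ P : ℕ → Bool, ((List.range n).filter P).map (lab ∘ vert) =
      ((List.range n).filter P).map (· + 1) := fun P =>
    List.map_congr_left fun i hi => hvert i (by simpa using (List.mem_filter.1 hi).1)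
  simp only [endpoints, endpointWord, wordPart, List.map_flatMap, List.map_append, List.map_map,
    ← Function.comp_assoc, Sum.elim_comp_inl, Sum.elim_comp_inr, h]

theorem mem_endpoints (A : ℕ → ℕ → Prop) (hlab : IsLabeling lab)
    (hvert : ∀ i < n, lab (vert i) = i + 1) (a : Fin n ⊕ Fin n) : a ∈ endpoints n A vert := by
  rcases a with v | v <;> obtain ⟨h1, -, h2⟩ := hlab.vert_lab_sub_one hvert v <;>
    simp only [endpoints, List.mem_flatMap, List.mem_append, List.mem_map, List.mem_filter,
      List.mem_range, decide_eq_true_eq, Function.comp_apply]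
  · have := rank_lt (A := A) h1
    exact ⟨n - 1 - rank n A (lab v - 1), by omega, .inr ⟨_, ⟨h1, by omega⟩, by rw [h2]⟩⟩
  · have := reach_lt (A := A) h1
    exact ⟨n - 1 - reach n A (lab v - 1), by omega, .inl ⟨_, ⟨h1, by omega⟩, by rw [h2]⟩⟩

theorem pairwise_endpoints (A : ℕ → ℕ → Prop) (hvert : ∀ i < n, lab (vert i) = i + 1) :
    (endpoints n A vert).Pairwise fun a b =>
      Sum.elim (fun v => leftKey n A (lab v - 1)) (fun v => rightKey n A (lab v - 1)) b <
        Sum.elim (fun v => leftKey n A (lab v - 1)) (fun v => rightKey n A (lab v - 1)) a := by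
  have hrange := List.pairwise_lt_range (n := n)
  rw [endpoints, List.pairwise_flatMap]
  constructor
  · intro q hq
    rw [List.pairwise_append, List.pairwise_map, List.pairwise_map]
    refine ⟨?_, ?_, ?_⟩
    · refine (List.Pairwise.and_mem.1 (hrange.filter _)).imp ?_
      rintro i j ⟨hi, hj, hij⟩
      simp only [List.mem_filter, List.mem_range, decide_eq_true_eq] at hi hj
      simp [hvert i hi.1, hvert j hj.1, rightKey, hi.2, hj.2]
      omega
    · refine (List.Pairwise.and_mem.1 (hrange.filter _)).imp ?_
      rintro i j ⟨hi, hj, hij⟩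
      simp only [List.mem_filter, List.mem_range, decide_eq_true_eq] at hi hj
      simp [hvert i hi.1, hvert j hj.1, leftKey, hi.2, hj.2]
      omega
    · simp only [List.mem_map, List.mem_filter, List.mem_range, decide_eq_true_eq]
      rintro _ ⟨i, hi, rfl⟩ _ ⟨j, hj, rfl⟩
      simp only [Function.comp_apply, Sum.elim_inl, Sum.elim_inr, hvert i hi.1, hvert j hj.1,
        Nat.add_sub_cancel, leftKey, rightKey, hi.2, hj.2]
      exact mul_add_lt_mul_add (by omega) (by omega)
  · refine (List.Pairwise.and_mem.1 hrange).imp ?_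
    rintro q q' ⟨hq, hq', hlt⟩ x hx y hy
    rw [List.mem_range] at hq hq'
    simp only [List.mem_append, List.mem_map, List.mem_filter, List.mem_range,
      decide_eq_true_eq] at hx hy
    rcases hx with ⟨i, hi, rfl⟩ | ⟨i, hi, rfl⟩ <;> rcases hy with ⟨j, hj, rfl⟩ | ⟨j, hj, rfl⟩ <;>
      simp only [Function.comp_apply, Sum.elim_inl, Sum.elim_inr, hvert i hi.1, hvert j hj.1,
        Nat.add_sub_cancel, leftKey, rightKey, hi.2, hj.2] <;>
      exact mul_add_lt_mul_add (by omega) (by omega)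

/-- The word that lists the owners of the endpoints is a representant, and comes from a model. -/
theorem endpointWord_spec {G : SimpleGraph (Fin n)} (hlab : IsLabeling lab)
    (hvert : ∀ i < n, lab (vert i) = i + 1)
    (hA : Admissible n fun i j => G.Adj (vert i) (vert j)) :
    IsRepresentant [1, 2] G lab (endpointWord n fun i j => G.Adj (vert i) (vert j)) ∧
      ∃ M : SimpleTriangleModel Gᶜ, M.OrderedBy lab ∧
        M.IsRightToLeftReading lab (endpointWord n fun i j => G.Adj (vert i) (vert j)) := by
  set A : ℕ → ℕ → Prop := fun i j => G.Adj (vert i) (vert j) with hAdef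
  have hlr : ∀ v, leftKey n A (lab v - 1) < rightKey n A (lab v - 1) := by
    intro v
    obtain ⟨h1, -, -⟩ := hlab.vert_lab_sub_one hvert v
    have := rank_le_reach h1 le_rfl (hA.irrefl (lab v - 1))
    exact mul_add_lt_mul_add (by omega) (by omega)
  have hG : ∀ x y, lab x < lab y →
      (G.Adj x y ↔ rightKey n A (lab x - 1) < leftKey n A (lab y - 1)) := by
    intro x y hxy
    obtain ⟨hx1, hx2, hx⟩ := hlab.vert_lab_sub_one hvert x
    obtain ⟨hy1, hy2, hy⟩ := hlab.vert_lab_sub_one hvert y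
    have h := hA.adj_iff_reach_lt_rank (i := lab x - 1) (j := lab y - 1) (by omega) hy1
    have hGA : A (lab x - 1) (lab y - 1) ↔ G.Adj x y := by simp only [hAdef, hx, hy]
    rw [← hGA, h]
    constructor
    · exact fun h => mul_add_lt_mul_add (by omega) (by omega)
    · intro hlt
      by_contra hle
      have : leftKey n A (lab y - 1) < rightKey n A (lab x - 1) :=
        mul_add_lt_mul_add (by omega) (by omega)
      omega
  rw [← map_endpoints A hvert]
  exact ⟨isRepresentant_of_sorted G hlab hlr hG (pairwise_endpoints A hvert)
    (mem_endpoints A hlab hvert), exists_model_of_sorted G hlab hlr hG (pairwise_endpoints A hvert)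
    (mem_endpoints A hlab hvert)⟩

end Endpoints

/-! ### Rules for reasoning about programs -/

namespace RAM

/-- Started in `s`, the program halts within `T` steps in a state that satisfies `Q`, and writes no
value greater than `B`. -/
def Run (B : ℕ) (p : Prog) (s : State) (T : ℕ) (Q : State → Prop) : Prop :=
  ∃ s' t, Exec B p s s' t ∧ t ≤ T ∧ Q s'

section Rules

variable {B T T' : ℕ} {p q : Prog} {s : State} {Q R : State → Prop}

theorem Run.mono (h : Run B p s T Q) (hT : T ≤ T') (hQ : ∀ s', Q s' → R s') : Run B p s T' R := by
  obtain ⟨s', t, h1, h2, h3⟩ := h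
  exact ⟨s', t, h1, h2.trans hT, hQ _ h3⟩

theorem Run.skip (h : Q s) : Run B .skip s 1 Q := ⟨s, 1, .skip s, le_rfl, h⟩

theorem Run.seq (h : Run B p s T R) (h' : ∀ s', R s' → Run B q s' T' Q) :
    Run B (.seq p q) s (T + T') Q := by
  obtain ⟨s', t, h1, h2, h3⟩ := h
  obtain ⟨s'', t', h4, h5, h6⟩ := h' s' h3
  exact ⟨s'', t + t', .seq h1 h4, by omega, h6⟩

theorem Run.ifLt {a b : ℕ} (h : s.reg a < s.reg b → Run B p s T Q)
    (h' : ¬ s.reg a < s.reg b → Run B q s T' Q) :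
    Run B (.ifLt a b p q) s (T + T' + 1) Q := by
  by_cases hab : s.reg a < s.reg b
  · obtain ⟨s', t, h1, h2, h3⟩ := h hab
    exact ⟨s', t + 1, .ifTrue hab h1, by omega, h3⟩
  · obtain ⟨s', t, h1, h2, h3⟩ := h' hab
    exact ⟨s', t + 1, .ifFalse hab h1, by omega, h3⟩

/-- Conditional execution if the contents of two registers agree. -/
def ifEq (a b : ℕ) (p : Prog) : Prog := .ifLt a b .skip (.ifLt b a .skip p)

theorem Run.ifEq {a b : ℕ} (h : s.reg a = s.reg b → Run B p s T Q) (h' : s.reg a ≠ s.reg b → Q s) :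
    Run B (ifEq a b p) s (T + 4) Q :=
  (Run.ifLt (T := 1) (T' := 1 + T + 1) (fun hab => .skip (h' hab.ne))
    (fun hab => .ifLt (fun hba => .skip (h' hba.ne')) fun hba => h (by omega))).mono
    (by omega) fun _ => id

/-- The counting loop: `I k` holds before the `k`-th pass. -/
theorem Run.whileLt {a b N : ℕ} {I : ℕ → State → Prop}
    (hI : ∀ k s, I k s → s.reg a = k ∧ s.reg b = N)
    (hstep : ∀ k < N, ∀ s, I k s → Run B p s T (I (k + 1))) (h0 : I 0 s) :
    Run B (.whileLt a b p) s (N * (T + 1) + 1) (I N) := by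
  suffices H : ∀ m k s, k + m = N → I k s →
      Run B (.whileLt a b p) s (m * (T + 1) + 1) (I N) from H N 0 s (by omega) h0
  intro m
  induction m with
  | zero =>
    intro k s hk hs
    obtain rfl : k = N := by omega
    obtain ⟨h1, h2⟩ := hI _ _ hs
    exact ⟨s, 1, .whileFalse (by omega), by omega, hs⟩
  | succ m ih =>
    intro k s hk hs
    obtain ⟨h1, h2⟩ := hI _ _ hs
    obtain ⟨s', t, h3, h4, h5⟩ := hstep k (by omega) s hs
    obtain ⟨s'', t', h6, h7, h8⟩ := ih (k + 1) s' (by omega) h5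
    exact ⟨s'', t + t' + 1, .whileTrue (by omega) h3 h6, by rw [Nat.succ_mul]; omega, h8⟩

/-- A straight-line program. -/
def block : List Op → Prog
  | [] => .skip
  | o :: os => .seq (.op o) (block os)

/-- The state after a straight-line program. -/
def runOps (os : List Op) (s : State) : State := os.foldl Op.apply s

/-- A straight-line program writes no value greater than `B`. -/
def Safe (B : ℕ) : List Op → State → Prop
  | [], _ => True
  | o :: os, s => o.value s ≤ B ∧ Safe B os (o.apply s)

theorem Run.block {os : List Op} (h : Safe B os s) (hQ : Q (runOps os s)) :
    Run B (block os) s (os.length + 1) Q := by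
  induction os generalizing s with
  | nil => exact Run.skip hQ
  | cons o os ih =>
    obtain ⟨s', t, h1, h2, h3⟩ := ih h.2 hQ
    exact ⟨s', 1 + t, .seq (.op o s h.1) h1, by simp only [List.length_cons]; omega, h3⟩

theorem Run.block_seq {os : List Op} (h : Safe B os s) (hq : Run B q (runOps os s) T Q) :
    Run B (.seq (RAM.block os) q) s (os.length + 1 + T) Q :=
  (Run.block h (Q := fun s' => s' = runOps os s) rfl).seq fun _ hs => hs ▸ hq

end Rules

/-! ### The program -/

/-- Register 10 is the index `v` of the vertex with the label `R₈ + 1`, if this vertex has been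
met by the loop over `R₉`. -/
def vertBody : Prog :=
  .seq (block [.add 12 11 9, .load 12 12, .add 13 8 2])
    (.seq (ifEq 12 13 (block [.move 10 9])) (block [.add 9 9 2]))

/-- Add to register 10 the entry of the adjacency matrix for the labels `R₉` and `R₈`, and append
the sum to the table of the numbers of neighbours. -/
def countBody : Prog :=
  block [.add 12 3 9, .load 12 12, .add 13 3 8, .load 13 13, .mul 12 12 0, .add 12 12 13,
    .load 12 12, .add 10 10 12, .store 7 10, .add 7 7 2, .add 9 9 2]

/-- Increase register 10 if the left endpoint of `R₉` precedes that of `R₈`. -/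
def rankBody : Prog :=
  .seq (block [.mul 12 9 0, .add 12 6 12, .mul 13 8 0, .add 13 6 13])
    (.seq (.ifLt 9 8
        (.seq (block [.add 14 12 9, .load 14 14, .add 15 13 9, .load 15 15])
          (.ifLt 14 15 (block [.add 10 10 2]) .skip))
        (.ifLt 8 9
          (.seq (block [.add 14 13 8, .load 14 14, .add 15 12 8, .load 15 15])
            (.ifLt 14 15 .skip (block [.add 10 10 2])))
          .skip))
      (block [.add 9 9 2]))

/-- Raise register 10 to the rank of `R₉`, if `R₈ ≤ R₉` and the two are not adjacent. -/
def reachBody : Prog :=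
  .seq (.ifLt 9 8 .skip
      (.seq (block [.add 12 3 8, .load 12 12, .add 13 3 9, .load 13 13, .mul 12 12 0,
          .add 12 12 13, .load 12 12])
        (.ifLt 12 2
          (.seq (block [.add 13 4 9, .load 13 13]) (.ifLt 10 13 (block [.move 10 13]) .skip))
          .skip)))
    (block [.add 9 9 2])

/-- Append the label of `R₉` to the output if its entry in the table at the address in register `b`
is `R₁₀`. -/
def outBody (b : ℕ) : Prog :=
  .seq (block [.add 12 b 9, .load 12 12])
    (.seq (ifEq 12 10 (block [.add 13 9 2, .store 7 13, .add 7 7 2])) (block [.add 9 9 2]))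

/-- Run an outer loop over `R₈ < n` around an initialization, an inner loop over `R₉ < n`, and a
final instruction sequence. -/
def nest (init : List Op) (body : Prog) (fin : Prog) : Prog :=
  .seq (block [.const 8 0])
    (.whileLt 8 0 (.seq (block init) (.seq (.whileLt 9 0 body) fin)))

/-- Append the contents of register 10 to a table and increase `R₈`. -/
def pushAcc : Prog := block [.store 7 10, .add 7 7 2, .add 8 8 2]

/-- The program. Register 0 holds `n`, register 2 holds `1`, register 7 is the address of the next
cell to be written; the registers 3, 4, 5, 6 and 11 hold the addresses of the tables of the
vertices, the ranks, the reaches, the numbers of neighbours and the labels. -/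
def program : Prog :=
  .seq (block [.const 2 1, .mul 11 0 0, .add 3 11 0, .add 6 3 0, .add 4 6 11, .add 5 4 0,
      .move 7 3])
    (.seq (nest [.const 9 0, .const 10 0] vertBody pushAcc)
    (.seq (nest [.const 9 0, .const 10 0] countBody (block [.add 8 8 2]))
    (.seq (nest [.const 9 0, .const 10 0] rankBody pushAcc)
    (.seq (nest [.const 9 0, .const 10 0] reachBody pushAcc)
    (.seq (nest [.const 9 0, .sub 10 0 8, .sub 10 10 2] (outBody 5)
        (.seq (block [.const 9 0]) (.seq (.whileLt 9 0 (outBody 4)) (block [.add 8 8 2]))))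
      (block [.add 0 5 0, .sub 1 7 0]))))))

/-! ### Correctness of the program -/

/-- The state of the memory in the course of the program: the cells below `L` agree with `F`, they
are followed by the output `out` produced so far, the loop counters are `i` and `k` and the
accumulator is `x`. -/
structure Snap (n : ℕ) (F : ℕ → ℕ) (L : ℕ) (out : List ℕ) (i k x : ℕ) (s : State) : Prop where
  r0 : s.reg 0 = n
  r2 : s.reg 2 = 1
  r3 : s.reg 3 = n * n + n
  r4 : s.reg 4 = 2 * (n * n) + 2 * n
  r5 : s.reg 5 = 2 * (n * n) + 3 * n
  r6 : s.reg 6 = n * n + 2 * n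
  r11 : s.reg 11 = n * n
  r7 : s.reg 7 = L + out.length
  r8 : s.reg 8 = i
  r9 : s.reg 9 = k
  r10 : s.reg 10 = x
  mem : ∀ a < L, s.mem a = F a
  out_eq : (List.range out.length).map (fun a => s.mem (L + a)) = out

/-- The memory `F` contains the adjacency matrix and the labels of the input, and the tables for the
graph `A` on the label numbers. -/
structure IsTable (n : ℕ) (A : ℕ → ℕ → Prop) (lab : ℕ → ℕ) (vert : ℕ → ℕ) (F : ℕ → ℕ) : Prop where
  vert_lt : ∀ i < n, vert i < n
  lab_eq_iff : ∀ i < n, ∀ v < n, lab v = i + 1 ↔ v = vert i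
  adj_of : ∀ i < n, ∀ j < n, A i j → F (vert i * n + vert j) = 1
  adj_of_not : ∀ i < n, ∀ j < n, ¬ A i j → F (vert i * n + vert j) = 0
  lab : ∀ v < n, F (n * n + v) = lab v
  vert : ∀ i < n, F (n * n + n + i) = vert i
  count : ∀ j < n, ∀ i < n, F (n * n + 2 * n + (j * n + i)) = (lowerNbrs A j i).card
  rank : ∀ i < n, F (2 * (n * n) + 2 * n + i) = rank n A i
  reach : ∀ i < n, F (2 * (n * n) + 3 * n + i) = reach n A i
  le : ∀ a, F a ≤ n


section Correctness

variable {n B : ℕ} {A : ℕ → ℕ → Prop} {lab vert F : ℕ → ℕ}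

/-- Instructions that touch only the counters, the accumulator and the scratch registers. -/
theorem Snap.of_regs {L i k x i' k' x' : ℕ} {out : List ℕ} {s s' : State}
    (h : Snap n F L out i k x s) (hm : s'.mem = s.mem)
    (hr : ∀ r ∈ [0, 2, 3, 4, 5, 6, 7, 11], s'.reg r = s.reg r)
    (h8 : s'.reg 8 = i') (h9 : s'.reg 9 = k') (h10 : s'.reg 10 = x') :
    Snap n F L out i' k' x' s' where
  r0 := (hr 0 (by simp)).trans h.r0
  r2 := (hr 2 (by simp)).trans h.r2
  r3 := (hr 3 (by simp)).trans h.r3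
  r4 := (hr 4 (by simp)).trans h.r4
  r5 := (hr 5 (by simp)).trans h.r5
  r6 := (hr 6 (by simp)).trans h.r6
  r11 := (hr 11 (by simp)).trans h.r11
  r7 := (hr 7 (by simp)).trans h.r7
  r8 := h8
  r9 := h9
  r10 := h10
  mem := hm ▸ h.mem
  out_eq := hm ▸ h.out_eq

/-- Writing the next entry of a table. -/
theorem Snap.push {L i k x i' k' x' : ℕ} {s s' : State} (h : Snap n F L [] i k x s)
    (hm : s'.mem = Function.update s.mem L (F L))
    (hr : ∀ r ∈ [0, 2, 3, 4, 5, 6, 11], s'.reg r = s.reg r) (h7 : s'.reg 7 = L + 1)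
    (h8 : s'.reg 8 = i') (h9 : s'.reg 9 = k') (h10 : s'.reg 10 = x') :
    Snap n F (L + 1) [] i' k' x' s' where
  r0 := (hr 0 (by simp)).trans h.r0
  r2 := (hr 2 (by simp)).trans h.r2
  r3 := (hr 3 (by simp)).trans h.r3
  r4 := (hr 4 (by simp)).trans h.r4
  r5 := (hr 5 (by simp)).trans h.r5
  r6 := (hr 6 (by simp)).trans h.r6
  r11 := (hr 11 (by simp)).trans h.r11
  r7 := h7
  r8 := h8
  r9 := h9
  r10 := h10
  mem a ha := by
    rw [hm, Function.update_apply]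
    split_ifs with h'
    · rw [h']
    · exact h.mem a (by omega)
  out_eq := rfl

/-- Writing the next letter of the output. -/
theorem Snap.emit {L i k x i' k' x' v : ℕ} {out : List ℕ} {s s' : State}
    (h : Snap n F L out i k x s)
    (hm : s'.mem = Function.update s.mem (L + out.length) v)
    (hr : ∀ r ∈ [0, 2, 3, 4, 5, 6, 11], s'.reg r = s.reg r) (h7 : s'.reg 7 = L + out.length + 1)
    (h8 : s'.reg 8 = i') (h9 : s'.reg 9 = k') (h10 : s'.reg 10 = x') :
    Snap n F L (out ++ [v]) i' k' x' s' where
  r0 := (hr 0 (by simp)).trans h.r0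
  r2 := (hr 2 (by simp)).trans h.r2
  r3 := (hr 3 (by simp)).trans h.r3
  r4 := (hr 4 (by simp)).trans h.r4
  r5 := (hr 5 (by simp)).trans h.r5
  r6 := (hr 6 (by simp)).trans h.r6
  r11 := (hr 11 (by simp)).trans h.r11
  r7 := by simpa [add_assoc] using h7
  r8 := h8
  r9 := h9
  r10 := h10
  mem a ha := by
    rw [hm, Function.update_apply, if_neg (by omega)]
    exact h.mem a ha
  out_eq := by
    rw [List.length_append, List.length_singleton, List.range_succ, List.map_append]
    congr 1
    · conv_rhs => rw [← h.out_eq]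
      refine List.map_congr_left fun a ha => ?_
      rw [List.mem_range] at ha
      rw [hm, Function.update_apply, if_neg (by omega)]
    · simp [hm]

theorem run_whileLt_snap {Tb i : ℕ} {body : Prog} {L g : ℕ → ℕ} {out : ℕ → List ℕ} {s : State}
    (hbody : ∀ k < n, ∀ s, Snap n F (L k) (out k) i k (g k) s →
      Run B body s Tb (Snap n F (L (k + 1)) (out (k + 1)) i (k + 1) (g (k + 1))))
    (hs : Snap n F (L 0) (out 0) i 0 (g 0) s) :
    Run B (.whileLt 9 0 body) s (n * (Tb + 1) + 1) (Snap n F (L n) (out n) i n (g n)) :=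
  Run.whileLt (I := fun k => Snap n F (L k) (out k) i k (g k)) (fun _ _ h => ⟨h.r9, h.r0⟩) hbody hs

/-- The rule for loop nests: `Lo i`, `outo i` describe the memory before the `i`-th pass of the outer
loop, and `Li i k`, `outi i k`, `g i k` the memory and the accumulator before the `k`-th pass of the
inner loop. -/
theorem run_nest {Ti Tb Tf : ℕ} {init : List Op} {body fin : Prog} {Lo : ℕ → ℕ}
    {outo : ℕ → List ℕ} {Li g : ℕ → ℕ → ℕ} {outi : ℕ → ℕ → List ℕ} {s : State}
    (hs : ∃ i k x, Snap n F (Lo 0) (outo 0) i k x s)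
    (hinit : ∀ i < n, ∀ s k x, Snap n F (Lo i) (outo i) i k x s →
      Run B (block init) s Ti (Snap n F (Li i 0) (outi i 0) i 0 (g i 0)))
    (hbody : ∀ i < n, ∀ k < n, ∀ s, Snap n F (Li i k) (outi i k) i k (g i k) s →
      Run B body s Tb (Snap n F (Li i (k + 1)) (outi i (k + 1)) i (k + 1) (g i (k + 1))))
    (hfin : ∀ i < n, ∀ s, Snap n F (Li i n) (outi i n) i n (g i n) s →
      Run B fin s Tf fun s' => ∃ k x, Snap n F (Lo (i + 1)) (outo (i + 1)) (i + 1) k x s') :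
    Run B (nest init body fin) s (2 + (n * (Ti + (n * (Tb + 1) + 1 + Tf) + 1) + 1))
      fun s' => ∃ i k x, Snap n F (Lo n) (outo n) i k x s' := by
  obtain ⟨i, k, x, hs⟩ := hs
  refine (Run.block_seq (T := n * (Ti + (n * (Tb + 1) + 1 + Tf) + 1) + 1)
    (Q := fun s' => ∃ k x, Snap n F (Lo n) (outo n) n k x s') ?_ ?_).mono (by simp)
    fun _ ⟨k, x, h⟩ => ⟨n, k, x, h⟩
  · simp [Safe, Op.value]
  · refine Run.whileLt (I := fun i s => ∃ k x, Snap n F (Lo i) (outo i) i k x s) ?_ ?_ ?_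
    · rintro i s ⟨k, x, h⟩
      exact ⟨h.r8, h.r0⟩
    · rintro i hi s ⟨k, x, h⟩
      exact (hinit i hi s k x h).seq fun s' h' =>
        (run_whileLt_snap (hbody i hi) h').seq (hfin i hi)
    · refine ⟨k, x, hs.of_regs ?_ ?_ ?_ ?_ ?_⟩ <;>
        simp [runOps, Op.apply, Op.value, State.setReg, Function.update_apply, hs.r9, hs.r10]

theorem run_init_zero {L i k x : ℕ} {s : State} (h : Snap n F L [] i k x s) :
    Run B (block [.const 9 0, .const 10 0]) s 3 (Snap n F L [] i 0 0) := by
  refine Run.block (by simp [Safe, Op.value]) (h.of_regs ?_ ?_ ?_ ?_ ?_) <;>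
    simp [runOps, Op.apply, Op.value, State.setReg, Function.update_apply, h.r8]

theorem run_pushAcc {L i k : ℕ} {s : State} (h : Snap n F L [] i k (F L) s) (hi : i < n)
    (hB : 20 * (n * n) ≤ B) (hL : L ≤ 10 * (n * n)) (hF : F L ≤ n) :
    Run B pushAcc s 4 fun s' => ∃ k x, Snap n F (L + 1) [] (i + 1) k x s' := by
  have hn := Nat.le_mul_self n
  have h7 : s.reg 7 = L := h.r7
  refine Run.block ?_ ⟨k, F L, h.push ?_ ?_ ?_ ?_ ?_ ?_⟩
  · simp [Safe, Op.value, Op.apply, State.setReg, State.setMem, h.r8, h.r10, h.r2, h7]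
    omega
  all_goals simp [runOps, Op.apply, Op.value, State.setReg, State.setMem, Function.update_apply,
    h.r2, h7, h.r8, h.r9, h.r10]

/-- A loop nest whose inner loop computes `g i n` step by step appends a table of these values. -/
theorem run_nest_pushAcc {Tb L : ℕ} {body : Prog} {g : ℕ → ℕ → ℕ} {s : State}
    (hB : 20 * (n * n) ≤ B) (hL : L + n ≤ 10 * (n * n))
    (hs : ∃ i k x, Snap n F L [] i k x s) (hg : ∀ i < n, g i 0 = 0)
    (hF : ∀ i < n, F (L + i) = g i n) (hle : ∀ a, F a ≤ n)
    (hbody : ∀ i < n, ∀ k < n, ∀ s, Snap n F (L + i) [] i k (g i k) s →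
      Run B body s Tb (Snap n F (L + i) [] i (k + 1) (g i (k + 1)))) :
    Run B (nest [.const 9 0, .const 10 0] body pushAcc) s
      (2 + (n * (3 + (n * (Tb + 1) + 1 + 4) + 1) + 1))
      fun s' => ∃ i k x, Snap n F (L + n) [] i k x s' := by
  refine run_nest (Lo := fun i => L + i) (outo := fun _ => []) (Li := fun i _ => L + i)
    (outi := fun _ _ => []) (g := g) hs ?_ hbody ?_
  · intro i hi s k x h
    rw [hg i hi]
    exact run_init_zero h
  · intro i hi s h
    rw [← hF i hi] at h
    exact run_pushAcc h hi hB (by show L + i ≤ _; omega) (hle _)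


end Correctness

/-! ### The loop bodies -/

section Bodies

variable {n B : ℕ} {A : ℕ → ℕ → Prop} {lab vert F : ℕ → ℕ}

attribute [local simp] runOps Safe Op.apply Op.value State.setReg State.setMem Function.update_apply

theorem run_next {L i k x : ℕ} {out : List ℕ} {s : State} (hB : 20 * (n * n) ≤ B) (hk : k < n)
    (h : Snap n F L out i k x s) :
    Run B (block [.add 9 9 2]) s 2 (Snap n F L out i (k + 1) x) := by
  have hn := Nat.le_mul_self n
  refine Run.block ?_ (h.of_regs ?_ ?_ ?_ ?_ ?_) <;> simp [h.r2, h.r8, h.r9, h.r10]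
  omega

theorem run_vertBody (hT : IsTable n A lab vert F) (hB : 20 * (n * n) ≤ B) {L i k : ℕ} {s : State}
    (hL : n * n + n ≤ L) (hi : i < n) (hk : k < n)
    (h : Snap n F L [] i k (if vert i < k then vert i else 0) s) :
    Run B vertBody s 20 (Snap n F L [] i (k + 1) (if vert i < k + 1 then vert i else 0)) := by
  have hn := Nat.le_mul_self n
  have hmem : s.mem (n * n + k) = lab k := by rw [h.mem _ (by omega), hT.lab k hk]
  have hle : lab k ≤ n := hT.lab k hk ▸ hT.le _
  have hiff := hT.lab_eq_iff i hi k hk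
  refine (Run.block_seq ?_ (Run.seq
    (R := Snap n F L [] i k (if vert i < k + 1 then vert i else 0))
    (Run.ifEq (T := 2) (fun heq => Run.block ?_ (h.of_regs ?_ ?_ ?_ ?_ ?_))
      fun hne => (h.of_regs ?_ ?_ ?_ ?_ ?_)) fun s' hs' => run_next hB hk hs')).mono
      (by simp) fun _ => id
  all_goals try simp [h.r2, h.r8, h.r9, h.r10, h.r11, hmem]
  · omega
  · omega
  · simp [h.r2, h.r8, h.r9, h.r11, hmem, hiff] at heq
    simp [← heq]
  · simp [h.r2, h.r8, h.r9, h.r11, hmem, hiff] at hne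
    congr 1
    simp only [eq_iff_iff]
    omega

open Classical in
/-- The partial sums that `countBody` computes. -/
noncomputable def countAcc (A : ℕ → ℕ → Prop) (i k : ℕ) : ℕ := ((Finset.range k).filter (A · i)).card

theorem countAcc_le (i k : ℕ) : countAcc A i k ≤ k := by
  classical
  exact (Finset.card_filter_le _ _).trans (Finset.card_range k).le

open Classical in
theorem countAcc_succ (i k : ℕ) : countAcc A i (k + 1) = countAcc A i k + if A k i then 1 else 0 := by
  rw [countAcc, countAcc, Finset.range_add_one, Finset.filter_insert]
  split_ifs <;> simp

open Classical in
/-- The partial sums that `rankBody` computes. -/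
noncomputable def rankAcc (A : ℕ → ℕ → Prop) (i k : ℕ) : ℕ :=
  ((Finset.range k).filter (Prec A · i)).card

theorem rankAcc_le (i k : ℕ) : rankAcc A i k ≤ k := by
  classical
  exact (Finset.card_filter_le _ _).trans (Finset.card_range k).le

open Classical in
theorem rankAcc_succ (i k : ℕ) :
    rankAcc A i (k + 1) = rankAcc A i k + if Prec A k i then 1 else 0 := by
  rw [rankAcc, rankAcc, Finset.range_add_one, Finset.filter_insert]
  split_ifs <;> simp

open Classical in
/-- The partial maxima that `reachBody` computes. -/
noncomputable def reachAcc (n : ℕ) (A : ℕ → ℕ → Prop) (i k : ℕ) : ℕ :=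
  ((Finset.range k).filter fun j => i ≤ j ∧ ¬ A i j).sup (rank n A)

open Classical in
theorem reachAcc_succ (i k : ℕ) :
    reachAcc n A i (k + 1) =
      if i ≤ k ∧ ¬ A i k then max (rank n A k) (reachAcc n A i k) else reachAcc n A i k := by
  rw [reachAcc, reachAcc, Finset.range_add_one, Finset.filter_insert]
  split_ifs <;> simp

theorem run_countBody (hT : IsTable n A lab vert F) (hB : 20 * (n * n) ≤ B) {i k : ℕ} {s : State}
    (hi : i < n) (hk : k < n)
    (h : Snap n F (n * n + 2 * n + i * n + k) [] i k (countAcc A i k) s) :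
    Run B countBody s 20
      (Snap n F (n * n + 2 * n + i * n + (k + 1)) [] i (k + 1) (countAcc A i (k + 1))) := by
  classical
  have hn := Nat.le_mul_self n
  have h7 : s.reg 7 = n * n + 2 * n + i * n + k := h.r7
  have hin : i * n + n ≤ n * n := by simpa [Nat.succ_mul] using Nat.mul_le_mul_right n hi
  have hvi := hT.vert_lt i hi
  have hvk := hT.vert_lt k hk
  have hvn : vert k * n + n ≤ n * n := by simpa [Nat.succ_mul] using Nat.mul_le_mul_right n hvk
  have hmi : s.mem (n * n + n + i) = vert i := by rw [h.mem _ (by omega), hT.vert i hi]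
  have hmk : s.mem (n * n + n + k) = vert k := by rw [h.mem _ (by omega), hT.vert k hk]
  have hadj : s.mem (vert k * n + vert i) = if A k i then 1 else 0 := by
    rw [h.mem _ (by omega)]
    split_ifs with hA
    · exact hT.adj_of k hk i hi hA
    · exact hT.adj_of_not k hk i hi hA
  have hle := countAcc_le (A := A) i (k + 1)
  have hF : F (n * n + 2 * n + i * n + k) = countAcc A i (k + 1) := by
    rw [add_assoc (n * n + 2 * n), hT.count i hi k hk]
    rfl
  rw [countAcc_succ] at hF hle ⊢
  refine (Run.block ?_ (h.push ?_ ?_ ?_ ?_ ?_ ?_)).mono (by simp) fun _ => id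
  all_goals simp [h.r0, h.r2, h.r3, h7, h.r8, h.r9, h.r10, hmi, hmk, hadj, hF]
  split_ifs at hle ⊢ <;> omega

theorem run_rankBody (hT : IsTable n A lab vert F) (hB : 20 * (n * n) ≤ B) {L i k : ℕ} {s : State}
    (hL : 2 * (n * n) + 2 * n ≤ L) (hi : i < n) (hk : k < n)
    (h : Snap n F L [] i k (rankAcc A i k) s) :
    Run B rankBody s 50 (Snap n F L [] i (k + 1) (rankAcc A i (k + 1))) := by
  classical
  have hn := Nat.le_mul_self n
  have hin : i * n + n ≤ n * n := by simpa [Nat.succ_mul] using Nat.mul_le_mul_right n hi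
  have hkn : k * n + n ≤ n * n := by simpa [Nat.succ_mul] using Nat.mul_le_mul_right n hk
  have hmem : ∀ a < n, ∀ b < n,
      s.mem (n * n + 2 * n + a * n + b) = (lowerNbrs A a b).card := by
    intro a ha b hb
    have han : a * n + n ≤ n * n := by simpa [Nat.succ_mul] using Nat.mul_le_mul_right n ha
    rw [h.mem _ (by omega), add_assoc (n * n + 2 * n), hT.count a ha b hb]
  have hcard : ∀ a < n, ∀ b < n, (lowerNbrs A a b).card ≤ B := by
    intro a ha b hb
    have := hT.count a ha b hb ▸ hT.le _
    omega
  have hle := rankAcc_le (A := A) i k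
  have hsucc := rankAcc_succ (A := A) i k
  refine (Run.block_seq ?_ (Run.seq (R := Snap n F L [] i k (rankAcc A i (k + 1)))
    (Run.ifLt (fun h1 => Run.block_seq ?_ (Run.ifLt
        (fun h2 => Run.block ?_ (h.of_regs ?_ ?_ ?_ ?_ ?_))
        (fun h2 => Run.skip (h.of_regs ?_ ?_ ?_ ?_ ?_))))
      (fun h1 => Run.ifLt (fun h1' => Run.block_seq ?_ (Run.ifLt
        (fun h2 => Run.skip (h.of_regs ?_ ?_ ?_ ?_ ?_))
        (fun h2 => Run.block ?_ (h.of_regs ?_ ?_ ?_ ?_ ?_))))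
        (fun h1' => Run.skip (h.of_regs ?_ ?_ ?_ ?_ ?_))))
    fun s' hs' => run_next hB hk hs')).mono (by simp) fun _ => id
  all_goals try simp [h.r0, h.r2, h.r6, h.r8, h.r9, h.r10, hmem, hi, hk, hcard]
  all_goals try simp [h.r8, h.r9] at h1
  all_goals try simp [h.r8, h.r9] at h1'
  all_goals try simp [h.r0, h.r6, h.r8, h.r9, hmem, hi, hk] at h2
  · omega
  · omega
  · omega
  · rw [hsucc, if_pos]
    rwa [Prec, if_pos h1]
  · rw [hsucc, if_neg, add_zero]
    rwa [Prec, if_pos h1, not_lt]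
  · omega
  · rw [hsucc, if_neg, add_zero]
    rw [Prec, if_neg h1.not_gt]
    exact fun h' => h'.2 h2
  · omega
  · rw [hsucc, if_pos]
    rw [Prec, if_neg h1.not_gt]
    exact ⟨h1', h2.not_gt⟩
  · obtain rfl : k = i := by omega
    rw [hsucc, if_neg (not_prec_self k), add_zero]

theorem run_reachBody (hT : IsTable n A lab vert F) (hB : 20 * (n * n) ≤ B) {L i k : ℕ} {s : State}
    (hL : 2 * (n * n) + 3 * n ≤ L) (hi : i < n) (hk : k < n)
    (h : Snap n F L [] i k (reachAcc n A i k) s) :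
    Run B reachBody s 50 (Snap n F L [] i (k + 1) (reachAcc n A i (k + 1))) := by
  classical
  have hn := Nat.le_mul_self n
  have hvi := hT.vert_lt i hi
  have hvk := hT.vert_lt k hk
  have hvn : vert i * n + n ≤ n * n := by simpa [Nat.succ_mul] using Nat.mul_le_mul_right n hvi
  have hmi : s.mem (n * n + n + i) = vert i := by rw [h.mem _ (by omega), hT.vert i hi]
  have hmk : s.mem (n * n + n + k) = vert k := by rw [h.mem _ (by omega), hT.vert k hk]
  have hadj : s.mem (vert i * n + vert k) = if A i k then 1 else 0 := by
    rw [h.mem _ (by omega)]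
    split_ifs with hA
    · exact hT.adj_of i hi k hk hA
    · exact hT.adj_of_not i hi k hk hA
  have hmr : s.mem (2 * (n * n) + 2 * n + k) = rank n A k := by
    rw [h.mem _ (by omega), hT.rank k hk]
  have hrk := rank_lt (A := A) hk
  have hsucc := reachAcc_succ (n := n) (A := A) i k
  refine (Run.seq (R := Snap n F L [] i k (reachAcc n A i (k + 1)))
    (Run.ifLt (fun h1 => Run.skip (h.of_regs ?_ ?_ ?_ ?_ ?_))
      (fun h1 => Run.block_seq ?_ (Run.ifLt
        (fun h2 => Run.block_seq ?_ (Run.ifLt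
          (fun h3 => Run.block ?_ (h.of_regs ?_ ?_ ?_ ?_ ?_))
          (fun h3 => Run.skip (h.of_regs ?_ ?_ ?_ ?_ ?_))))
        (fun h2 => Run.skip (h.of_regs ?_ ?_ ?_ ?_ ?_)))))
    fun s' hs' => run_next hB hk hs').mono (by simp) fun _ => id
  all_goals try simp [h.r0, h.r2, h.r3, h.r4, h.r8, h.r9, h.r10, hmi, hmk, hadj, hmr]
  all_goals try simp [h.r8, h.r9] at h1
  all_goals try simp [h.r0, h.r2, h.r3, h.r8, h.r9, hmi, hmk, hadj] at h2
  all_goals try simp [h.r4, h.r9, h.r10, hmr] at h3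
  · rw [hsucc, if_neg (by omega)]
  · split_ifs <;> omega
  · omega
  · omega
  · rw [hsucc, if_pos ⟨h1, h2⟩, max_eq_left h3.le]
  · rw [hsucc, if_pos ⟨h1, h2⟩, max_eq_right h3]
  · rw [hsucc, if_neg (by simp [h2])]

/-- The pass over one of the tables `f` of ranks and reaches, at the address in register `b`. -/
theorem run_outBody {b c : ℕ} {f : ℕ → ℕ} {p : ℕ} (hB : 20 * (n * n) ≤ B)
    {L i k : ℕ} {out : List ℕ} {s : State} (hL : c + n ≤ L)
    (hlen : L + out.length ≤ 19 * (n * n)) (hk : k < n) (hbc : s.reg b = c)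
    (hf : F (c + k) = f k) (hle : f k ≤ n)
    (h : Snap n F L (out ++ ((List.range k).filter (f · = p)).map (· + 1)) i k p s) :
    Run B (outBody b) s 30
      (Snap n F L (out ++ ((List.range (k + 1)).filter (f · = p)).map (· + 1)) i (k + 1) p) := by
  have hn := Nat.le_mul_self n
  have hmem : s.mem (c + k) = f k := by rw [h.mem _ (by omega), hf]
  have hlen' : ((List.range k).filter (f · = p)).length ≤ k := by
    simpa using List.length_filter_le (f · = p) (List.range k)
  have h7 := h.r7
  simp only [List.length_append, List.length_map] at h7
  refine (Run.block_seq ?_ (Run.seq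
    (R := Snap n F L (out ++ ((List.range (k + 1)).filter (f · = p)).map (· + 1)) i k p)
    (Run.ifEq (T := 4) (fun heq => Run.block ?_ ?_) fun hne => ?_)
    fun s' hs' => run_next hB hk hs')).mono (by simp) fun _ => id
  · simp [h.r9, hbc, hmem]
    omega
  · simp [h.r2, h7, h.r9, hbc, hmem]
    omega
  · have heq' : f k = p := by simpa [h.r9, h.r10, hbc, hmem] using heq
    rw [List.range_succ, List.filter_append, List.map_append, ← List.append_assoc,
      List.filter_singleton, decide_eq_true heq', cond_true, List.map_singleton]
    refine h.emit ?_ ?_ ?_ ?_ ?_ ?_ <;> simp [h.r2, h7, h.r8, h.r9, h.r10, hbc, hmem, add_assoc]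
  · have hne' : f k ≠ p := by simpa [h.r9, h.r10, hbc, hmem] using hne
    rw [List.range_succ, List.filter_append, List.filter_singleton, decide_eq_false hne',
      cond_false, List.append_nil]
    refine h.of_regs ?_ ?_ ?_ ?_ ?_ <;> simp [h.r8, h.r9, h.r10]

end Bodies

/-! ### The loop nests -/

section Phases

variable {n B : ℕ} {A : ℕ → ℕ → Prop} {lab vert F : ℕ → ℕ} {s : State}

attribute [local simp] runOps Safe Op.apply Op.value State.setReg State.setMem Function.update_apply

/-- `Snap` without the values of the loop counters and of the accumulator. -/
def Filled (n : ℕ) (F : ℕ → ℕ) (L : ℕ) (out : List ℕ) (s : State) : Prop :=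
  ∃ i k x, Snap n F L out i k x s

theorem run_vertPhase (hT : IsTable n A lab vert F) (hB : 20 * (n * n) ≤ B)
    (hs : Filled n F (n * n + n) [] s) :
    Run B (nest [.const 9 0, .const 10 0] vertBody pushAcc) s
      (2 + (n * (3 + (n * (20 + 1) + 1 + 4) + 1) + 1)) (Filled n F (n * n + 2 * n) []) := by
  have hn := Nat.le_mul_self n
  rw [show n * n + 2 * n = n * n + n + n by ring]
  refine run_nest_pushAcc (g := fun i k => if vert i < k then vert i else 0) hB (by omega) hs ?_ ?_
    hT.le ?_
  · simp
  · intro i hi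
    simp only [hT.vert i hi, hT.vert_lt i hi, if_true]
  · exact fun i hi k hk s h => run_vertBody hT hB (by omega) hi hk h

theorem run_countPhase (hT : IsTable n A lab vert F) (hB : 20 * (n * n) ≤ B)
    (hs : Filled n F (n * n + 2 * n) [] s) :
    Run B (nest [.const 9 0, .const 10 0] countBody (block [.add 8 8 2])) s
      (2 + (n * (3 + (n * (20 + 1) + 1 + 2) + 1) + 1)) (Filled n F (2 * (n * n) + 2 * n) []) := by
  have hn := Nat.le_mul_self n
  rw [show 2 * (n * n) + 2 * n = n * n + 2 * n + n * n by ring]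
  refine run_nest (Lo := fun i => n * n + 2 * n + i * n) (outo := fun _ => [])
    (Li := fun i k => n * n + 2 * n + i * n + k) (outi := fun _ _ => []) (g := countAcc A)
    (by simpa [Filled] using hs) ?_ ?_ ?_
  · exact fun i hi s k x h => run_init_zero h
  · exact fun i hi k hk s h => run_countBody hT hB hi hk h
  · intro i hi s h
    rw [add_assoc _ (i * n), ← Nat.succ_mul] at h
    refine Run.block ?_ ⟨_, _, h.of_regs ?_ ?_ ?_ rfl rfl⟩ <;> simp [h.r2, h.r8]
    omega

theorem run_rankPhase (hT : IsTable n A lab vert F) (hB : 20 * (n * n) ≤ B)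
    (hs : Filled n F (2 * (n * n) + 2 * n) [] s) :
    Run B (nest [.const 9 0, .const 10 0] rankBody pushAcc) s
      (2 + (n * (3 + (n * (50 + 1) + 1 + 4) + 1) + 1)) (Filled n F (2 * (n * n) + 3 * n) []) := by
  have hn := Nat.le_mul_self n
  rw [show 2 * (n * n) + 3 * n = 2 * (n * n) + 2 * n + n by ring]
  refine run_nest_pushAcc (g := rankAcc A) hB (by omega) hs ?_ ?_ hT.le ?_
  · simp [rankAcc]
  · exact fun i hi => hT.rank i hi
  · exact fun i hi k hk s h => run_rankBody hT hB (by omega) hi hk h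

theorem run_reachPhase (hT : IsTable n A lab vert F) (hB : 20 * (n * n) ≤ B)
    (hs : Filled n F (2 * (n * n) + 3 * n) [] s) :
    Run B (nest [.const 9 0, .const 10 0] reachBody pushAcc) s
      (2 + (n * (3 + (n * (50 + 1) + 1 + 4) + 1) + 1)) (Filled n F (2 * (n * n) + 4 * n) []) := by
  have hn := Nat.le_mul_self n
  rw [show 2 * (n * n) + 4 * n = 2 * (n * n) + 3 * n + n by ring]
  refine run_nest_pushAcc (g := reachAcc n A) hB (by omega) hs ?_ ?_ hT.le ?_
  · simp [reachAcc]
  · exact fun i hi => hT.reach i hi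
  · exact fun i hi k hk s h => run_reachBody hT hB (by omega) hi hk h

/-- The first `i` parts of the word. -/
noncomputable def wordPrefix (n : ℕ) (A : ℕ → ℕ → Prop) (i : ℕ) : List ℕ :=
  (List.range i).flatMap fun q => wordPart n A (n - 1 - q)

theorem wordPrefix_succ (i : ℕ) :
    wordPrefix n A (i + 1) = wordPrefix n A i ++
      ((List.range n).filter (reach n A · = n - 1 - i)).map (· + 1) ++
      ((List.range n).filter (rank n A · = n - 1 - i)).map (· + 1) := by
  simp [wordPrefix, List.range_succ, wordPart]

theorem length_filter_range_le (p : ℕ → Bool) (n : ℕ) : ((List.range n).filter p).length ≤ n :=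
  (List.length_filter_le _ _).trans (List.length_range).le

theorem length_wordPrefix_le (i : ℕ) : (wordPrefix n A i).length ≤ 2 * (i * n) := by
  induction i with
  | zero => simp [wordPrefix]
  | succ i ih =>
    have h1 := length_filter_range_le (reach n A · = n - 1 - i) n
    have h2 := length_filter_range_le (rank n A · = n - 1 - i) n
    rw [wordPrefix_succ, List.length_append, List.length_append, List.length_map, List.length_map,
      Nat.add_mul]
    omega

theorem run_outPhase (hT : IsTable n A lab vert F) (hB : 20 * (n * n) ≤ B)
    (hs : Filled n F (2 * (n * n) + 4 * n) [] s) :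
    Run B (nest [.const 9 0, .sub 10 0 8, .sub 10 10 2] (outBody 5)
        (.seq (block [.const 9 0]) (.seq (.whileLt 9 0 (outBody 4)) (block [.add 8 8 2])))) s
      (2 + (n * (4 + (n * (30 + 1) + 1 + (2 + (n * (30 + 1) + 1 + 2))) + 1) + 1))
      (Filled n F (2 * (n * n) + 4 * n) (endpointWord n A)) := by
  have hn := Nat.le_mul_self n
  refine run_nest (Lo := fun _ => 2 * (n * n) + 4 * n) (outo := wordPrefix n A)
    (Li := fun _ _ => 2 * (n * n) + 4 * n)
    (outi := fun i k => wordPrefix n A i ++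
      ((List.range k).filter (reach n A · = n - 1 - i)).map (· + 1))
    (g := fun i _ => n - 1 - i) (by simpa [Filled, wordPrefix] using hs) ?_ ?_ ?_
  · intro i hi s k x h
    simp only [List.range_zero, List.filter_nil, List.map_nil, List.append_nil]
    refine Run.block ?_ (h.of_regs ?_ ?_ ?_ ?_ ?_) <;> simp [h.r0, h.r2, h.r8]
    all_goals omega
  · intro i hi k hk s h
    have hlen := length_wordPrefix_le (n := n) (A := A) i
    have hin := Nat.mul_le_mul_right n hi.le
    exact run_outBody (c := 2 * (n * n) + 3 * n) hB (by omega) (by omega) hk h.r5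
      (hT.reach k hk) (reach_lt hk).le h
  · intro i hi s h
    have hlen := length_wordPrefix_le (n := n) (A := A) i
    have hin := Nat.mul_le_mul_right n hi.le
    have hfil := length_filter_range_le (reach n A · = n - 1 - i) n
    refine Run.seq (R := Snap n F (2 * (n * n) + 4 * n) (wordPrefix n A i ++
      ((List.range n).filter (reach n A · = n - 1 - i)).map (· + 1)) i 0 (n - 1 - i))
      (Run.block ?_ (h.of_regs ?_ ?_ ?_ ?_ ?_)) fun s' hs' =>
      (run_whileLt_snap (F := F) (i := i) (L := fun _ => 2 * (n * n) + 4 * n) (g := fun _ => n - 1 - i)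
        (out := fun k => wordPrefix n A i ++
          ((List.range n).filter (reach n A · = n - 1 - i)).map (· + 1) ++
          ((List.range k).filter (rank n A · = n - 1 - i)).map (· + 1)) ?_ ?_).seq fun s'' h'' => ?_
    · simp
    · simp
    · simp
    · simp [h.r8]
    · simp
    · simp [h.r10]
    · intro k hk s h
      refine run_outBody (c := 2 * (n * n) + 2 * n) hB (by omega) ?_ hk h.r4
        (hT.rank k hk) (rank_lt hk).le h
      rw [List.length_append, List.length_map]
      omega
    · simpa using hs'
    · rw [← wordPrefix_succ] at h''
      refine Run.block ?_ ⟨_, _, h''.of_regs ?_ ?_ ?_ rfl rfl⟩ <;> simp [h''.r2, h''.r8]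
      omega

/-- From a memory that agrees with `F` on the input, the program writes the word. -/
theorem run_program (hT : IsTable n A lab vert F) (hB : 20 * (n * n) ≤ B) (hn1 : 1 ≤ n)
    (h0 : s.reg 0 = n) (hmem : ∀ a < n * n + n, s.mem a = F a) :
    Run B program s (300 * (n * n)) fun s' => s'.output = endpointWord n A := by
  have hn := Nat.le_mul_self n
  have hlen := length_wordPrefix_le (n := n) (A := A) n
  refine (Run.seq (R := Filled n F (n * n + n) []) (Run.block ?_ ?_) fun s' hs' =>
    (run_vertPhase hT hB hs').seq fun s' hs' => (run_countPhase hT hB hs').seq fun s' hs' =>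
    (run_rankPhase hT hB hs').seq fun s' hs' => (run_reachPhase hT hB hs').seq fun s' hs' =>
    (run_outPhase hT hB hs').seq (T' := 3) fun s' hs' => ?_).mono ?_ fun _ => id
  · simp [h0]
    omega
  · refine ⟨s.reg 8, s.reg 9, s.reg 10, ?_⟩
    constructor <;> simp [h0] <;> first | exact hmem | ring
  · obtain ⟨i, k, x, h⟩ := hs'
    have h7 := h.r7
    have h4 : 2 * (n * n) + 3 * n + n = 2 * (n * n) + 4 * n := by ring
    change (endpointWord n A).length ≤ _ at hlen
    refine Run.block ?_ ?_
    · simp [h.r0, h.r5, h7, h4]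
      omega
    · rw [State.output]
      simpa [h.r0, h.r5, h7, h4] using h.out_eq
  · simp only [List.length_cons, List.length_nil]
    ring_nf
    ring_nf at hn
    nlinarith

end Phases

/-! ### The input and the tables -/

/-- The memory after the computation of all tables. -/
noncomputable def tables (n : ℕ) (A : ℕ → ℕ → Prop) (vert input : ℕ → ℕ) (a : ℕ) : ℕ :=
  if a < n * n + n then input a
  else if a < n * n + 2 * n then vert (a - (n * n + n))
  else if a < 2 * (n * n) + 2 * n then
    (lowerNbrs A ((a - (n * n + 2 * n)) / n) ((a - (n * n + 2 * n)) % n)).card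
  else if a < 2 * (n * n) + 3 * n then rank n A (a - (2 * (n * n) + 2 * n))
  else if a < 2 * (n * n) + 4 * n then reach n A (a - (2 * (n * n) + 3 * n))
  else 0

theorem div_mod_mul_add {n a b : ℕ} (hb : b < n) : (a * n + b) / n = a ∧ (a * n + b) % n = b :=
  (Nat.div_mod_unique (by omega)).2 ⟨by ring, hb⟩

section Input

variable {n : ℕ} {G : SimpleGraph (Fin n)} {lab : Fin n → ℕ}

open Classical in
theorem inputState_mem_adj (u v : Fin n) :
    (inputState G lab).mem (u * n + v) = if G.Adj u v then 1 else 0 := by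
  have h : (u : ℕ) * n + v < n * n := by nlinarith [u.2, v.2]
  obtain ⟨h1, h2⟩ := div_mod_mul_add (a := u) v.2
  simp only [inputState, h, dif_pos, h1, h2]

theorem inputState_mem_lab (v : Fin n) : (inputState G lab).mem (n * n + v) = lab v := by
  simp [inputState]

theorem inputState_mem_le (hlab : IsLabeling lab) (hn : 1 ≤ n) (a : ℕ) :
    (inputState G lab).mem a ≤ n := by
  have := fun v => (Finset.mem_Icc.1 (hlab.2 v)).2
  simp only [Fintype.card_fin] at this
  simp only [inputState]
  split_ifs
  exacts [hn, Nat.zero_le _, this _, Nat.zero_le _]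

theorem isTable_tables (hlab : IsLabeling lab) (hn : 1 ≤ n) {vert : ℕ → Fin n}
    (hvert : ∀ i < n, lab (vert i) = i + 1) :
    IsTable n (fun i j => G.Adj (vert i) (vert j))
      (fun v => (inputState G lab).mem (n * n + v)) (fun i => vert i)
      (tables n (fun i j => G.Adj (vert i) (vert j)) (fun i => vert i)
        (inputState G lab).mem) where
  vert_lt i _ := (vert i).2
  lab_eq_iff i hi v hv := by
    have := inputState_mem_lab (G := G) (lab := lab) ⟨v, hv⟩
    simp only at this
    rw [this, ← hvert i hi, hlab.1.eq_iff, Fin.ext_iff]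
  adj_of i hi j hj h := by
    have : (vert i : ℕ) * n + vert j < n * n + n := by nlinarith [(vert i).2, (vert j).2]
    rw [tables, if_pos this, inputState_mem_adj, if_pos h]
  adj_of_not i hi j hj h := by
    have : (vert i : ℕ) * n + vert j < n * n + n := by nlinarith [(vert i).2, (vert j).2]
    rw [tables, if_pos this, inputState_mem_adj, if_neg h]
  lab v hv := by rw [tables, if_pos (by omega)]
  vert i hi := by
    rw [tables, if_neg (by omega), if_pos (by omega)]
    simp
  count j hj i hi := by
    have : j * n + n ≤ n * n := by simpa [Nat.succ_mul] using Nat.mul_le_mul_right n hj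
    obtain ⟨h1, h2⟩ := div_mod_mul_add (a := j) hi
    rw [tables, if_neg (by omega), if_neg (by omega), if_pos (by omega), Nat.add_sub_cancel_left,
      h1, h2]
  rank i hi := by
    rw [tables, if_neg (by omega), if_neg (by omega), if_neg (by omega), if_pos (by omega),
      Nat.add_sub_cancel_left]
  reach i hi := by
    rw [tables, if_neg (by omega), if_neg (by omega), if_neg (by omega), if_neg (by omega),
      if_pos (by omega), Nat.add_sub_cancel_left]
  le a := by
    classical
    unfold tables
    split_ifs
    · exact inputState_mem_le hlab hn a
    · exact (vert _).2.le
    · refine (Finset.card_filter_le _ _).trans ?_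
      rw [Finset.card_range]
      exact Nat.mod_lt _ hn
    · exact (rank_lt (by omega)).le
    · exact (reach_lt (by omega)).le
    · omega

end Input

end RAM

theorem mainTheorem6 :
    ∃ (p : RAM.Prog) (C : ℕ), ∀ n : ℕ, 1 ≤ n →
      ∀ (G : SimpleGraph (Fin n)) (lab : Fin n → ℕ),
        IsLabeling lab →
        IsFreeLabeling {⟨3, graphI3⟩, ⟨4, graphJ4⟩, ⟨4, graphQ4⟩} G lab →
        ∃ (s : RAM.State) (t : ℕ),
          RAM.Exec (C * n ^ 2) p (RAM.inputState G lab) s t ∧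
          t ≤ C * n ^ 2 ∧
          IsRepresentant [1, 2] G lab s.output ∧
          ∃ M : SimpleTriangleModel Gᶜ,
            M.OrderedBy lab ∧ M.IsRightToLeftReading lab s.output := by
  refine ⟨RAM.program, 300, fun n hn G lab hlab hG => ?_⟩
  obtain ⟨vert, hvert⟩ := hlab.exists_vert hn
  obtain ⟨s, t, hexec, ht, hout⟩ := RAM.run_program (B := 300 * n ^ 2)
    (RAM.isTable_tables (G := G) hlab hn hvert) (by nlinarith) hn rfl
    (fun a ha => by rw [RAM.tables, if_pos ha])
  refine ⟨s, t, hexec, by nlinarith, ?_⟩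
  rw [hout]
  exact endpointWord_spec hlab hvert (admissible_of_isFreeLabeling hvert hG)
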